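/- Let $p,q\ge 3$ be integers and let $\mathbb X$ be the sphere $\mathbb S^2$, the Euclidean plane $\mathbb R^2$ or the hyperbolic plane $\mathbb H^2$, according as $\frac1p+\frac1q$ is greater than, equal to or smaller than $\frac12$. Let $F\subset\mathbb X$ be a closed triangle with angles $\frac\pi2,\frac\pi p,\frac\pi q$, and let $$G_{p,q}=\langle a,b,c \mid a^2=b^2=c^2=(ab)^q=(ac)^2=(bc)^p=1\rangle$$ act on $\mathbb X$ by isometries, where $a$, $b$, $c$ act as the reflections in the lines spanned by the sides of $F$ opposite to the angles $\frac\pi p$, $\frac\pi2$, $\frac\pi q$, respectively. Let $T_{p,q}=\{gF : g\in G_{p,q}\}$, and consider the following tilings of $\mathbb X$: the regular tiling $(q^p)$ by the $q$-gons $g\bigcup_{d\in\langle a,b\rangle}dF$, the regular tiling $(p^q)$ by the $p$-gons $g\bigcup_{d\in\langle b,c\rangle}dF$, and the Laves tiling $[p.q.p.q]$ by the quadrilaterals $g\bigcup_{d\in\langle a,c\rangle}dF$, where $g\in G_{p,q}$. Let $k\ge1$. A $k$-colouring of a tiling $\mathcal T$ is a surjective map $d:\mathcal T\to\{1,\dots,k\}$.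 It is perfect (with respect to $G_{p,q}$) if for every $g\in G_{p,q}$ there is a permutation $\pi$ of $\{1,\dots,k\}$ with $d(gP)=\pi(d(P))$ for all $P\in\mathcal T$. A subgroup $S$ of index $k$ in $G_{p,q}$ induces the colouring $d$ of $\mathcal T$ if, for some numbering of the left cosets of $S$ by $1,\dots,k$, the map that assigns to each triangle $gF$ the number of $gS$ is a well-defined colouring of $T_{p,q}$ and every triangle of $T_{p,q}$ contained in a tile $P\in\mathcal T$ has the colour $d(P)$. Then: 1. The group of transformations of $\mathbb X$ given by $G_{p,q}$ is the group of all isometries of $\mathbb X$ that map $(q^p)$ to itself; likewise for $(p^q)$ and, if $p\ne q$, for $[p.q.p.q]$. (So perfect means perfect with respect to the full symmetry group, except for $[p.q.p.q]$ with $p=q$.) 2. Let $S$ be a subgroup of index $k$ in $G_{p,q}$. Then $S$ induces a perfect $k$-colouring of $(q^p)$ if and only if $a,b\in S$; of $(p^q)$ if and only if $b,c\in S$; and of $[p.q.p.q]$ if and only if $a,c\in S$. 3. A map from $(q^p)$ to $\{1,\dots,k\}$ is a perfect $k$-colouring if and only if it is induced by some subgroup $S$ of index $k$ with $a,b\in S$;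 likewise for $(p^q)$ with $b,c\in S$, and for $[p.q.p.q]$ with $a,c\in S$. 4. The stabilisers in $G_{p,q}$ of the vertices of $F$ with angles $\frac\pi q$, $\frac\pi p$, $\frac\pi2$ (a vertex, the centre of a face and the midpoint of an edge of $(p^q)$) are $\langle a,b\rangle$, $\langle b,c\rangle$ and $\langle a,c\rangle$, respectively. -/

import Mathlib

open scoped Pointwise

noncomputable section

namespace PerfectColouring

/-! ### The sphere, the Euclidean plane and the hyperbolic plane -/

/-- The bilinear form `n₀m₀ + n₁m₁ + κ n₂m₂` on normal vectors of lines. -/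
def normalForm (κ : ℝ) (n m : Fin 3 → ℝ) : ℝ := n 0 * m 0 + n 1 * m 1 + κ * (n 2 * m 2)

/-- The value at `v` of the linear form with coefficients `n`. -/
def pairing (n v : Fin 3 → ℝ) : ℝ := n 0 * v 0 + n 1 * v 1 + n 2 * v 2

/-- The plane of constant curvature `κ`, for `κ ∈ {1, 0, -1}`, as the surface
`z² + κ (x² + y²) = 1` in `ℝ³`, with `z > 0` if `κ ≤ 0`. It is the unit sphere for `κ = 1`, the
Euclidean plane `z = 1` for `κ = 0` and the upper sheet of the hyperboloid for `κ = -1`. -/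
def Plane (κ : ℝ) : Type :=
  {v : Fin 3 → ℝ // v 2 ^ 2 + κ * (v 0 ^ 2 + v 1 ^ 2) = 1 ∧ (κ ≤ 0 → 0 < v 2)}

/-- The spherical, Euclidean or hyperbolic distance. -/
def planeDist {κ : ℝ} (x y : Plane κ) : ℝ :=
  if 0 < κ then Real.arccos (x.1 0 * y.1 0 + x.1 1 * y.1 1 + x.1 2 * y.1 2)
  else if κ = 0 then Real.sqrt ((x.1 0 - y.1 0) ^ 2 + (x.1 1 - y.1 1) ^ 2)
  else Real.arcosh (x.1 2 * y.1 2 - x.1 0 * y.1 0 - x.1 1 * y.1 1)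

/-- The group of all isometries of the plane of curvature `κ`. -/
def isometryGroup (κ : ℝ) : Subgroup (Equiv.Perm (Plane κ)) where
  carrier := {f | ∀ x y, planeDist (f x) (f y) = planeDist x y}
  mul_mem' {f g} hf hg x y := by
    rw [Equiv.Perm.mul_apply, Equiv.Perm.mul_apply, hf, hg]
  one_mem' _ _ := rfl
  inv_mem' {f} hf x y := by
    have h := hf (f⁻¹ x) (f⁻¹ y)
    simpa using h.symm

/-! ### Reflections in lines -/

/-- The formula for the reflection in the line `{v | pairing n v = 0}`, where `n` is a unit normal,
that is `normalForm κ n n = 1`. -/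
def reflectVec (κ : ℝ) (n v : Fin 3 → ℝ) : Fin 3 → ℝ :=
  v - (2 * pairing n v) • ![n 0, n 1, κ * n 2]

theorem reflectVec_zero (κ : ℝ) (n v : Fin 3 → ℝ) :
    reflectVec κ n v 0 = v 0 - 2 * pairing n v * n 0 := by simp [reflectVec]

theorem reflectVec_one (κ : ℝ) (n v : Fin 3 → ℝ) :
    reflectVec κ n v 1 = v 1 - 2 * pairing n v * n 1 := by simp [reflectVec]

theorem reflectVec_two (κ : ℝ) (n v : Fin 3 → ℝ) :
    reflectVec κ n v 2 = v 2 - 2 * pairing n v * (κ * n 2) := by simp [reflectVec]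

theorem pairing_reflectVec {κ : ℝ} {n : Fin 3 → ℝ} (hn : normalForm κ n n = 1) (v : Fin 3 → ℝ) :
    pairing n (reflectVec κ n v) = - pairing n v := by
  have h : pairing n (reflectVec κ n v) = pairing n v - 2 * pairing n v * normalForm κ n n := by
    simp only [pairing, normalForm, reflectVec_zero, reflectVec_one, reflectVec_two]; ring
  rw [h, hn]; ring

theorem reflectVec_reflectVec {κ : ℝ} {n : Fin 3 → ℝ} (hn : normalForm κ n n = 1)
    (v : Fin 3 → ℝ) : reflectVec κ n (reflectVec κ n v) = v := by
  have h := pairing_reflectVec hn v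
  rw [reflectVec, h, reflectVec]
  module

theorem reflectVec_mem {κ : ℝ} {n : Fin 3 → ℝ} (hn : normalForm κ n n = 1) {v : Fin 3 → ℝ}
    (hv : v 2 ^ 2 + κ * (v 0 ^ 2 + v 1 ^ 2) = 1 ∧ (κ ≤ 0 → 0 < v 2)) :
    reflectVec κ n v 2 ^ 2 + κ * (reflectVec κ n v 0 ^ 2 + reflectVec κ n v 1 ^ 2) = 1 ∧
      (κ ≤ 0 → 0 < reflectVec κ n v 2) := by
  obtain ⟨hv1, hv2⟩ := hv
  have key : reflectVec κ n v 2 ^ 2 + κ * (reflectVec κ n v 0 ^ 2 + reflectVec κ n v 1 ^ 2) = 1 := by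
    have : reflectVec κ n v 2 ^ 2 + κ * (reflectVec κ n v 0 ^ 2 + reflectVec κ n v 1 ^ 2) =
        (v 2 ^ 2 + κ * (v 0 ^ 2 + v 1 ^ 2)) +
          4 * κ * pairing n v ^ 2 * (normalForm κ n n - 1) := by
      simp only [pairing, normalForm, reflectVec_zero, reflectVec_one, reflectVec_two]; ring
    rw [this, hn, hv1]; ring
  refine ⟨key, fun hκ => ?_⟩
  have hz := hv2 hκ
  by_contra hcon
  push Not at hcon
  set z' := reflectVec κ n v 2 with hz'
  set x' := reflectVec κ n v 0 with hx'
  set y' := reflectVec κ n v 1 with hy'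
  have hprod : v 2 * z' + κ * (v 0 * x' + v 1 * y') = 1 - 2 * κ * pairing n v ^ 2 := by
    have : v 2 * z' + κ * (v 0 * x' + v 1 * y') =
        (v 2 ^ 2 + κ * (v 0 ^ 2 + v 1 ^ 2)) - 2 * κ * pairing n v ^ 2 := by
      rw [hz', hx', hy', reflectVec_zero, reflectVec_one, reflectVec_two]
      simp only [pairing]; ring
    rw [this, hv1]
  have h1 : 1 ≤ v 2 * z' + κ * (v 0 * x' + v 1 * y') := by
    rw [hprod]; nlinarith [mul_nonneg (neg_nonneg.2 hκ) (sq_nonneg (pairing n v))]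
  -- the squares of the two sides contradict the Cauchy-Schwarz inequality
  set s := -κ with hs
  have hs0 : 0 ≤ s := by rw [hs]; linarith
  have hκs : κ = -s := by rw [hs]; ring
  have h2 : 1 + v 2 * (-z') ≤ s * -(v 0 * x' + v 1 * y') := by rw [hκs] at h1; linarith
  have hA : v 2 ^ 2 = 1 + s * (v 0 ^ 2 + v 1 ^ 2) := by rw [hκs] at hv1; linarith
  have hB : z' ^ 2 = 1 + s * (x' ^ 2 + y' ^ 2) := by rw [hκs] at key; linarith
  have hnn : 0 ≤ v 2 * (-z') := mul_nonneg hz.le (by linarith)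
  have hsq : (1 + v 2 * (-z')) ^ 2 ≤ (s * -(v 0 * x' + v 1 * y')) ^ 2 :=
    pow_le_pow_left₀ (by linarith) h2 2
  have hCS : (s * -(v 0 * x' + v 1 * y')) ^ 2 ≤
      (s * (v 0 ^ 2 + v 1 ^ 2)) * (s * (x' ^ 2 + y' ^ 2)) := by
    nlinarith [mul_nonneg (sq_nonneg s) (sq_nonneg (v 0 * y' - v 1 * x'))]
  have hP : 0 ≤ s * (v 0 ^ 2 + v 1 ^ 2) := by positivity
  have hQ : 0 ≤ s * (x' ^ 2 + y' ^ 2) := by positivity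
  have hAB : (v 2 * (-z')) ^ 2 =
      (1 + s * (v 0 ^ 2 + v 1 ^ 2)) * (1 + s * (x' ^ 2 + y' ^ 2)) := by
    rw [← hA, ← hB]; ring
  nlinarith

/-- The reflection of the plane of curvature `κ` in the line with unit normal `n`. -/
def lineReflection {κ : ℝ} (n : Fin 3 → ℝ) (hn : normalForm κ n n = 1) :
    Equiv.Perm (Plane κ) where
  toFun x := ⟨reflectVec κ n x.1, reflectVec_mem hn x.2⟩
  invFun x := ⟨reflectVec κ n x.1, reflectVec_mem hn x.2⟩
  left_inv x := Subtype.ext (reflectVec_reflectVec hn x.1)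
  right_inv x := Subtype.ext (reflectVec_reflectVec hn x.1)

theorem lineReflection_sq {κ : ℝ} {n : Fin 3 → ℝ} (hn : normalForm κ n n = 1) :
    lineReflection n hn ^ 2 = 1 := by
  ext1 x
  rw [pow_two]
  exact Subtype.ext (reflectVec_reflectVec hn x.1)

theorem lineReflection_mul_sq {κ : ℝ} {n m : Fin 3 → ℝ} (hn : normalForm κ n n = 1)
    (hm : normalForm κ m m = 1) (h : normalForm κ n m = 0) :
    (lineReflection n hn * lineReflection m hm) ^ 2 = 1 := by
  have h1 : ∀ v, pairing n (reflectVec κ m v) = pairing n v := fun v => by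
    have : pairing n (reflectVec κ m v) = pairing n v - 2 * pairing m v * normalForm κ n m := by
      simp only [pairing, normalForm, reflectVec_zero, reflectVec_one, reflectVec_two]; ring
    rw [this, h]; ring
  have hcomm : ∀ v, reflectVec κ n (reflectVec κ m v) = reflectVec κ m (reflectVec κ n v) := by
    intro v
    have h2 : pairing m (reflectVec κ n v) = pairing m v := by
      have : pairing m (reflectVec κ n v) = pairing m v - 2 * pairing n v * normalForm κ n m := by
        simp only [pairing, normalForm, reflectVec_zero, reflectVec_one, reflectVec_two]; ring
      rw [this, h]; ring
    rw [reflectVec, h1, reflectVec, reflectVec, h2, reflectVec]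
    module
  ext1 x
  rw [pow_two]
  refine Subtype.ext ?_
  change reflectVec κ n (reflectVec κ m (reflectVec κ n (reflectVec κ m x.1))) = x.1
  rw [hcomm x.1, reflectVec_reflectVec hm, reflectVec_reflectVec hn]

/-- Two reflections in lines that enclose the angle `π / N` generate a dihedral group. -/
theorem lineReflection_mul_pow {κ : ℝ} {n m : Fin 3 → ℝ} (hn : normalForm κ n n = 1)
    (hm : normalForm κ m m = 1) {N : ℕ} (hN : 3 ≤ N)
    (h : normalForm κ n m = - Real.cos (Real.pi / N)) :
    (lineReflection n hn * lineReflection m hm) ^ N = 1 := by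
  have hN0 : (N : ℝ) ≠ 0 := by positivity
  let lin (n : Fin 3 → ℝ) : Module.Dual ℝ (Fin 3 → ℝ) :=
    { toFun := fun v => 2 * pairing n v
      map_add' := fun v w => by simp only [pairing, Pi.add_apply]; ring
      map_smul' := fun r v => by
        simp only [pairing, Pi.smul_apply, smul_eq_mul, RingHom.id_apply]; ring }
  let vec (n : Fin 3 → ℝ) : Fin 3 → ℝ := ![n 0, n 1, κ * n 2]
  have hlin : ∀ n m, lin n (vec m) = 2 * normalForm κ n m := fun n m => by
    simp [lin, vec, pairing, normalForm]; ring
  have hsymm : normalForm κ m n = normalForm κ n m := by simp only [normalForm]; ring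
  have hfn : lin n (vec n) = 2 := by rw [hlin, hn]; norm_num
  have hfm : lin m (vec m) = 2 := by rw [hlin, hm]; norm_num
  set θ : ℝ := 2 * (Real.pi / N) with hθ
  have ht : 2 * Real.cos θ = lin n (vec m) * lin m (vec n) - 2 := by
    rw [hlin, hlin, hsymm, h, hθ, Real.cos_two_mul]; ring
  have hsin : Real.sin θ ≠ 0 := by
    have h3 : (3 : ℝ) ≤ N := by exact_mod_cast hN
    refine (Real.sin_pos_of_pos_of_lt_pi (by positivity) ?_).ne'
    rw [hθ, ← mul_div_assoc, div_lt_iff₀ (by positivity)]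
    nlinarith [Real.pi_pos]
  have hS : ∀ j : ℤ, (Polynomial.Chebyshev.S ℝ j).eval (2 * Real.cos θ) =
      Real.sin ((j + 1) * θ) / Real.sin θ := fun j => by
    rw [eq_div_iff hsin, Polynomial.Chebyshev.S_two_mul_real_cos]
  have hlinpow : ∀ v, ((Module.reflection hfn * Module.reflection hfm) ^ N) v = v := by
    intro v
    rw [Module.reflection_mul_reflection_pow_apply hfn hfm N v _ ht]
    rcases Nat.even_or_odd' N with ⟨j, hj | hj⟩
    · have e1 : ((N : ℤ) - 2) / 2 = j - 1 := by omega
      have e2 : ((N : ℤ) - 1) / 2 = j - 1 := by omega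
      have hz : (Polynomial.Chebyshev.S ℝ ((j : ℤ) - 1)).eval (2 * Real.cos θ) = 0 := by
        rw [hS]
        have : (((j : ℤ) - 1 : ℤ) + 1 : ℝ) * θ = Real.pi := by
          have hj' : (N : ℝ) = 2 * j := by exact_mod_cast hj
          push_cast
          rw [hθ]
          field_simp
          rw [hj']; ring
        rw [this, Real.sin_pi, zero_div]
      rw [e1, e2, hz]; simp
    · have e1 : ((N : ℤ) - 1) / 2 = j := by omega
      have e2 : ((N : ℤ) - 3) / 2 = j - 1 := by omega
      have e3 : (N : ℤ) / 2 = j := by omega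
      have e4 : ((N : ℤ) - 2) / 2 = j - 1 := by omega
      have hz : (Polynomial.Chebyshev.S ℝ (j : ℤ)).eval (2 * Real.cos θ) +
          (Polynomial.Chebyshev.S ℝ ((j : ℤ) - 1)).eval (2 * Real.cos θ) = 0 := by
        rw [hS, hS]
        have hj' : (N : ℝ) = 2 * j + 1 := by exact_mod_cast hj
        have a1 : (((j : ℤ) : ℝ) + 1) * θ = Real.pi / N + Real.pi := by
          push_cast; rw [hθ]; field_simp; rw [hj']; ring
        have a2 : ((((j : ℤ) - 1 : ℤ) : ℝ) + 1) * θ = Real.pi - Real.pi / N := by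
          push_cast; rw [hθ]; field_simp; rw [hj']; ring
        rw [a1, a2, Real.sin_add_pi, Real.sin_pi_sub]; ring
      rw [e1, e2, e3, e4, hz]; simp
  have hone : ∀ (n : Fin 3 → ℝ) (hf : lin n (vec n) = 2) (v : Fin 3 → ℝ),
      Module.reflection hf v = reflectVec κ n v := fun n hf v => by
    rw [Module.reflection_apply]; rfl
  have htransfer : ∀ (j : ℕ) (x : Plane κ),
      (((lineReflection n hn * lineReflection m hm) ^ j) x).1 =
        ((Module.reflection hfn * Module.reflection hfm) ^ j) x.1 := by
    intro j
    induction j with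
    | zero => intro x; rfl
    | succ j ih =>
      intro x
      rw [pow_succ, pow_succ, Equiv.Perm.mul_apply, ih, LinearEquiv.mul_apply,
        LinearEquiv.mul_apply, hone, hone]
      rfl
  ext1 x
  refine Subtype.ext ?_
  rw [htransfer, hlinpow]
  rfl

/-! ### The orthogonal triangle with angles `π / 2`, `π / p`, `π / q` -/

section Triangle

variable (p q : ℕ)

/-- The curvature of the plane that is tiled: `1`, `0` or `-1` according as `1/p + 1/q` is greater
than, equal to or smaller than `1/2`. -/
def curvature : ℝ :=
  if (1 / 2 : ℝ) < 1 / p + 1 / q then 1 else if (1 / p + 1 / q : ℝ) = 1 / 2 then 0 else -1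

/-- The sphere, the Euclidean plane or the hyperbolic plane, whichever is tiled by `(p^q)`. -/
abbrev Space : Type := Plane (curvature p q)

/-- First coordinate of the unit normal of side `a`. -/
def normalAx : ℝ := - (Real.cos (Real.pi / q) / Real.sin (Real.pi / p))

/-- Third coordinate of the unit normal of side `a`. In the Euclidean plane, where it only fixes
the size of the triangle, it is `1`. -/
def normalAz : ℝ :=
  if curvature p q = 0 then 1 else Real.sqrt |1 - normalAx p q ^ 2|

/-- Inward unit normal of the side opposite to the angle `π / p`. -/
def normalA : Fin 3 → ℝ := ![normalAx p q, 0, normalAz p q]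

/-- Inward unit normal of the side opposite to the angle `π / 2`. -/
def normalB : Fin 3 → ℝ := ![Real.sin (Real.pi / p), - Real.cos (Real.pi / p), 0]

/-- Inward unit normal of the side opposite to the angle `π / q`. -/
def normalC : Fin 3 → ℝ := ![0, 1, 0]

/-- The closed triangle `F` with angles `π / 2`, `π / p`, `π / q`: by the lemmas `normalForm_ab`,
`normalForm_ac`, `normalForm_bc` below, the inward unit normals `n, m` of two sides that enclose the
angle `α` satisfy `normalForm n m = - cos α`. -/
def triangle : Set (Space p q) :=
  {x | 0 ≤ pairing (normalA p q) x.1 ∧ 0 ≤ pairing (normalB p) x.1 ∧ 0 ≤ pairing normalC x.1}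

theorem normalForm_bb : normalForm (curvature p q) (normalB p) (normalB p) = 1 := by
  have := Real.sin_sq_add_cos_sq (Real.pi / p)
  simp [normalForm, normalB]; nlinarith

theorem normalForm_cc : normalForm (curvature p q) normalC normalC = 1 := by
  simp [normalForm, normalC]

theorem normalForm_ac : normalForm (curvature p q) (normalA p q) normalC = 0 := by
  simp [normalForm, normalA, normalC]

theorem normalForm_bc :
    normalForm (curvature p q) (normalB p) normalC = - Real.cos (Real.pi / p) := by
  simp [normalForm, normalB, normalC]

theorem pi_div_bounds (n : ℕ) (hn : 3 ≤ n) : 0 < Real.pi / n ∧ Real.pi / n < Real.pi / 2 := by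
  have h3 : (3 : ℝ) ≤ n := by exact_mod_cast hn
  have hpi := Real.pi_pos
  exact ⟨by positivity, div_lt_div_of_pos_left hpi (by norm_num) (by linarith)⟩

theorem sin_pi_div_pos (n : ℕ) (hn : 3 ≤ n) : 0 < Real.sin (Real.pi / n) := by
  obtain ⟨h1, h2⟩ := pi_div_bounds n hn
  exact Real.sin_pos_of_pos_of_lt_pi h1 (by linarith [Real.pi_pos])

theorem normalForm_ab [hp : Fact (3 ≤ p)] :
    normalForm (curvature p q) (normalA p q) (normalB p) = - Real.cos (Real.pi / q) := by
  have h := (sin_pi_div_pos p hp.out).ne'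
  simp [normalForm, normalA, normalB, normalAx]
  field_simp

variable [hp : Fact (3 ≤ p)] [hq : Fact (3 ≤ q)]

theorem normalForm_aa : normalForm (curvature p q) (normalA p q) (normalA p q) = 1 := by
  obtain ⟨hp1, hp2⟩ := pi_div_bounds p hp.out
  obtain ⟨hq1, hq2⟩ := pi_div_bounds q hq.out
  have hs := sin_pi_div_pos p hp.out
  have hpi := Real.pi_pos
  have hc : Real.cos (Real.pi / q) = Real.sin (Real.pi / 2 - Real.pi / q) := by
    rw [Real.sin_pi_div_two_sub]
  have hc0 : 0 < Real.cos (Real.pi / q) := Real.cos_pos_of_mem_Ioo ⟨by linarith, hq2⟩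
  have hangle : Real.pi / p - (Real.pi / 2 - Real.pi / q) =
      Real.pi * ((1 / p + 1 / q : ℝ) - 1 / 2) := by ring
  have key : normalAx p q ^ 2 + curvature p q * normalAz p q ^ 2 = 1 := by
    have hx : normalAx p q ^ 2 = (Real.cos (Real.pi / q) / Real.sin (Real.pi / p)) ^ 2 := by
      rw [normalAx, neg_sq]
    rcases lt_trichotomy (1 / 2 : ℝ) (1 / p + 1 / q) with hlt | heq | hgt
    · have hκ : curvature p q = 1 := if_pos hlt
      have hlt' : Real.cos (Real.pi / q) < Real.sin (Real.pi / p) := by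
        rw [hc]
        refine Real.sin_lt_sin_of_lt_of_le_pi_div_two (by linarith) hp2.le ?_
        nlinarith [mul_pos hpi (sub_pos.2 hlt)]
      have h1 : normalAx p q ^ 2 < 1 := by
        rw [hx]
        exact pow_lt_one₀ (by positivity) ((div_lt_one hs).2 hlt') two_ne_zero
      rw [hκ, normalAz, hκ, if_neg one_ne_zero, Real.sq_sqrt (abs_nonneg _),
        abs_of_pos (by linarith)]
      ring
    · have hκ : curvature p q = 0 := by
        rw [curvature, if_neg (by rw [← heq]; exact lt_irrefl _), if_pos heq.symm]
      have he : Real.cos (Real.pi / q) = Real.sin (Real.pi / p) := by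
        rw [hc]; congr 1
        rw [← heq] at hangle; linarith
      rw [hκ, hx, he, div_self hs.ne']; ring
    · have hκ : curvature p q = -1 := by
        rw [curvature, if_neg hgt.not_gt, if_neg hgt.ne]
      have hlt' : Real.sin (Real.pi / p) < Real.cos (Real.pi / q) := by
        rw [hc]
        refine Real.sin_lt_sin_of_lt_of_le_pi_div_two (by linarith) (by linarith) ?_
        nlinarith [mul_pos hpi (sub_pos.2 hgt)]
      have h1 : 1 < normalAx p q ^ 2 := by
        rw [hx]
        exact one_lt_pow₀ ((one_lt_div hs).2 hlt') two_ne_zero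
      rw [hκ, normalAz, hκ, if_neg (by norm_num), Real.sq_sqrt (abs_nonneg _),
        abs_of_neg (by linarith)]
      ring
  rw [← key]
  simp [normalForm, normalA]; ring

theorem normalA_sq : normalAx p q ^ 2 + curvature p q * normalAz p q ^ 2 = 1 := by
  rw [← normalForm_aa p q]
  simp [normalForm, normalA]; ring

theorem normalAx_neg : normalAx p q < 0 := by
  obtain ⟨hq1, hq2⟩ := pi_div_bounds q hq.out
  have hc0 : 0 < Real.cos (Real.pi / q) :=
    Real.cos_pos_of_mem_Ioo ⟨by linarith [Real.pi_pos], hq2⟩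
  exact neg_lt_zero.2 (div_pos hc0 (sin_pi_div_pos p hp.out))

/-- The vertex of the triangle with angle `π / p`; it is the centre of a face of `(p^q)`. -/
def faceCentre : Space p q := ⟨![0, 0, 1], by simp⟩

/-- The vertex of the triangle with the right angle; it is the midpoint of an edge of `(p^q)`. -/
def edgeMidpoint : Space p q := ⟨![normalAz p q, 0, - normalAx p q], by
  have h := normalA_sq p q
  refine ⟨?_, fun _ => ?_⟩
  · simpa using h
  · simpa using normalAx_neg p q⟩

/-- The vertex of the triangle with angle `π / q`; it is a vertex of `(p^q)`. -/
def vertexPoint : Space p q :=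
  ⟨(Real.sin (Real.pi / q))⁻¹ • ![normalAz p q * Real.cos (Real.pi / p),
    normalAz p q * Real.sin (Real.pi / p), - normalAx p q * Real.cos (Real.pi / p)], by
  have h := normalA_sq p q
  have hs := sin_pi_div_pos p hp.out
  have hs' := sin_pi_div_pos q hq.out
  obtain ⟨hp1, hp2⟩ := pi_div_bounds p hp.out
  have hc : 0 < Real.cos (Real.pi / p) :=
    Real.cos_pos_of_mem_Ioo ⟨by linarith [Real.pi_pos], hp2⟩
  have e1 := Real.sin_sq_add_cos_sq (Real.pi / p)
  have e2 := Real.sin_sq_add_cos_sq (Real.pi / q)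
  have e3 : normalAx p q * Real.sin (Real.pi / p) = - Real.cos (Real.pi / q) := by
    rw [normalAx]; field_simp
  refine ⟨?_, fun _ => ?_⟩
  · simp
    field_simp
    have e4 : normalAx p q ^ 2 * Real.sin (Real.pi / p) ^ 2 = Real.cos (Real.pi / q) ^ 2 := by
      rw [← mul_pow, e3, neg_sq]
    linear_combination h + (normalAx p q ^ 2 + curvature p q * normalAz p q ^ 2) * e1 - e4 - e2
  · simpa using mul_neg_of_pos_of_neg (inv_pos.2 hs')
      (mul_neg_of_neg_of_pos (normalAx_neg p q) hc)⟩

end Triangle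

/-! ### The Coxeter group `G_{p,q}` and its action -/

/-- The names of the three generators. -/
inductive Gen
  | a
  | b
  | c

/-- The relators `a², b², c², (ab)^q, (ac)², (bc)^p`. -/
def relators (p q : ℕ) : Set (FreeGroup Gen) :=
  let a := FreeGroup.of Gen.a
  let b := FreeGroup.of Gen.b
  let c := FreeGroup.of Gen.c
  {a ^ 2, b ^ 2, c ^ 2, (a * b) ^ q, (a * c) ^ 2, (b * c) ^ p}

/-- `G_{p,q} = ⟨a, b, c | a² = b² = c² = (ab)^q = (ac)² = (bc)^p = 1⟩`. -/
abbrev CoxeterG (p q : ℕ) : Type := PresentedGroup (relators p q)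

/-- The generators of `G_{p,q}`. -/
def genA (p q : ℕ) : CoxeterG p q := PresentedGroup.of Gen.a
def genB (p q : ℕ) : CoxeterG p q := PresentedGroup.of Gen.b
def genC (p q : ℕ) : CoxeterG p q := PresentedGroup.of Gen.c

section Action

variable (p q : ℕ) [hp : Fact (3 ≤ p)] [hq : Fact (3 ≤ q)]

/-- The reflections in the three sides of the triangle. -/
def sideReflection : Gen → Equiv.Perm (Space p q)
  | .a => lineReflection (normalA p q) (normalForm_aa p q)
  | .b => lineReflection (normalB p) (normalForm_bb p q)
  | .c => lineReflection normalC (normalForm_cc p q)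

theorem sideReflection_relators :
    ∀ r ∈ relators p q, FreeGroup.lift (sideReflection p q) r = 1 := by
  intro r hr
  simp only [relators, Set.mem_insert_iff, Set.mem_singleton_iff] at hr
  rcases hr with rfl | rfl | rfl | rfl | rfl | rfl <;>
    simp only [map_pow, map_mul, FreeGroup.lift_apply_of]
  · exact lineReflection_sq (normalForm_aa p q)
  · exact lineReflection_sq (normalForm_bb p q)
  · exact lineReflection_sq (normalForm_cc p q)
  · exact lineReflection_mul_pow (normalForm_aa p q) (normalForm_bb p q) hq.out
      (normalForm_ab p q)
  · exact lineReflection_mul_sq (normalForm_aa p q) (normalForm_cc p q) (normalForm_ac p q)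
  · exact lineReflection_mul_pow (normalForm_bb p q) (normalForm_cc p q) hp.out
      (normalForm_bc p q)

/-- `G_{p,q}` acts on the plane: `a`, `b`, `c` act as the reflections in the sides of the triangle
opposite to the angles `π / p`, `π / 2`, `π / q`, respectively. -/
def toPerm : CoxeterG p q →* Equiv.Perm (Space p q) :=
  PresentedGroup.toGroup (sideReflection_relators p q)

instance : MulAction (CoxeterG p q) (Space p q) := MulAction.compHom _ (toPerm p q)

/-- `G_{p,q}` as a group of transformations of the plane. -/
def transformationGroup : Subgroup (Equiv.Perm (Space p q)) := (toPerm p q).range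

/-! ### The tilings -/

/-- The tiling `T_{p,q}` by the triangles `gF`. -/
def triangleTiling : Set (Set (Space p q)) := Set.range fun g : CoxeterG p q => g • triangle p q

variable {p q} in
/-- The union of the triangles `dF` with `d ∈ D`. -/
def patch (D : Subgroup (CoxeterG p q)) : Set (Space p q) := ⋃ d ∈ D, d • triangle p q

variable {p q} in
/-- The collection of all images under `G_{p,q}` of the union of the triangles `dF`, `d ∈ D`. -/
def orbitTiling (D : Subgroup (CoxeterG p q)) : Set (Set (Space p q)) :=
  Set.range fun g : CoxeterG p q => g • patch D

/-- The regular tiling `(p^q)`. A tile is the regular `p`-gon formed by the `2p` triangles around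
the vertex of `F` with angle `π / p`. -/
def tilingPQ : Set (Set (Space p q)) := orbitTiling (Subgroup.closure {genB p q, genC p q})

/-- The regular tiling `(q^p)`, dual to `(p^q)`. A tile is the regular `q`-gon formed by the `2q`
triangles around the vertex of `F` with angle `π / q`. -/
def tilingQP : Set (Set (Space p q)) := orbitTiling (Subgroup.closure {genA p q, genB p q})

/-- The Laves tiling `[p.q.p.q]`, whose edges are the segments that join the centres of the `p`-gons
of `(p^q)` to their vertices, that is, the images of the hypotenuse of `F`. A tile is the
quadrilateral formed by the four triangles around the right angle of `F`. -/
def tilingLaves : Set (Set (Space p q)) := orbitTiling (Subgroup.closure {genA p q, genC p q})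

end Action

/-! ### Symmetries, colourings, perfect colourings -/

/-- The symmetry group of a tiling: all isometries of the plane that map the tiling to itself. -/
def symmetryGroup {κ : ℝ} (𝒯 : Set (Set (Plane κ))) : Subgroup (Equiv.Perm (Plane κ)) :=
  isometryGroup κ ⊓ MulAction.stabilizer (Equiv.Perm (Plane κ)) 𝒯

/-- The pair `(f, π)` is a colour symmetry of the colouring `c`: the tile `f P` has colour
`π (c P)`. -/
def IsColourSymmetry {κ : ℝ} {𝒯 : Set (Set (Plane κ))} {k : ℕ} (c : 𝒯 → Fin k)
    (f : Equiv.Perm (Plane κ)) (π : Equiv.Perm (Fin k)) : Prop :=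
  ∀ P Q : 𝒯, (Q : Set (Plane κ)) = f • (P : Set (Plane κ)) → c Q = π (c P)

/-- `c` is a `k`-colouring (all `k` colours occur) that is perfect with respect to the group `H` of
symmetries: every element of `H` permutes the colours. -/
def IsPerfectColouring {κ : ℝ} {𝒯 : Set (Set (Plane κ))} {k : ℕ}
    (H : Subgroup (Equiv.Perm (Plane κ))) (c : 𝒯 → Fin k) : Prop :=
  Function.Surjective c ∧ ∀ f ∈ H, ∃ π : Equiv.Perm (Fin k), IsColourSymmetry c f π

section Induced

variable {p q k : ℕ} [Fact (3 ≤ p)] [Fact (3 ≤ q)]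

/-- `c` is a left coset colouring of `T_{p,q}`: for some numbering of the left cosets of `S` by the
`k` colours, the triangle `gF` has the number of `gS` as its colour. -/
def IsLeftCosetColouring (S : Subgroup (CoxeterG p q)) (c : triangleTiling p q → Fin k) : Prop :=
  ∃ e : CoxeterG p q ⧸ S ≃ Fin k, ∀ g : CoxeterG p q,
    c ⟨g • triangle p q, g, rfl⟩ = e (QuotientGroup.mk g)

/-- The subgroup `S` induces the colouring `d` of the tiling `𝒯`: in a left coset colouring of
`T_{p,q}`, all triangles that form a tile have the same colour, and this is its colour under `d`. -/
def Induces (S : Subgroup (CoxeterG p q)) {𝒯 : Set (Set (Space p q))} (d : 𝒯 → Fin k) : Prop :=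
  ∃ c : triangleTiling p q → Fin k, IsLeftCosetColouring S c ∧
    ∀ (P : 𝒯) (t : triangleTiling p q), (t : Set (Space p q)) ⊆ P → c t = d P

/-- `S` induces a `k`-colouring of `𝒯` that is perfect with respect to `H`. -/
def InducesPerfect (k : ℕ) (H : Subgroup (Equiv.Perm (Space p q))) (S : Subgroup (CoxeterG p q))
    (𝒯 : Set (Set (Space p q))) : Prop :=
  ∃ d : 𝒯 → Fin k, IsPerfectColouring H d ∧ Induces S d

end Induced

end PerfectColouring

end

open PerfectColouring

open scoped Pointwise

set_option linter.unusedSectionVars false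

namespace PerfectColouring

/-! ### Walls, heights and word length -/

section Tits

variable (p q : ℕ)

/-! Two facts reduce the theorem to cosets: the triangle `gF` determines `g`, and an isometry that
preserves a tile belongs to the group, with one exception, the Laves tiling with `p = q`.

The first fact is Tits' argument. If the word length of `s g` is not smaller than that of `g`, then
`gF` lies on the positive side of the wall of `s` (`height_smul_of_wordLength_le`); the induction
peels off a maximal alternating word in two generators and computes in their dihedral group. Hence
every `g ≠ 1` carries `F` to the nonpositive side of some wall, and the interior of `F` strictly to
the negative side. So only `1` sends an interior point of `F` into `F`
(`eq_one_of_smul_mem_triangle`), and the stabiliser of a point of `F` is generated by the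
reflections in the walls through it (`mem_of_smul_eq_self`). This yields the vertex stabilisers, and
identifies triangles with elements of `G` and the tiles built from a subgroup `D` with left cosets
of `D` (`smul_patch_eq_iff`).

A colouring of tiles is then a function on `G / D`. If it is perfect, the elements that preserve the
colour of the base tile form a subgroup `S` containing `D`, and colours correspond to left cosets of
`S`. Conversely, if `D ≤ S`, the projection from `G / D` to `G / S` is a perfect colouring.

For the symmetry groups, a symmetry of the tiling is first composed with a group element so that it
preserves the base tile. Let `u` be the centre of this tile, a vertex of `F`, and let `t` be the
vertex of `F` farther from `u` than the remaining one. The tile lies in the disc about `u` through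
`t`, and `u` is the only point within this radius of all rotated copies of `t`
(`eq_vert_of_sqDist_rotation_le`), so `u` is fixed. The image of `t` is again at maximal distance,
hence an image of `t` under `D`. After one more correction two vertices are fixed, which leaves the
identity or one reflection. The argument needs a farther vertex: for the two regular tilings the
hypotenuse beats a leg, and for the Laves tiling the two legs differ when `p ≠ q`. Squared chord
lengths `sqDist` treat the three geometries together. -/

/-- The generator of `G_{p,q}` with the given name. -/
def gen (s : Gen) : CoxeterG p q := PresentedGroup.of s

/-- The inward unit normals of the sides of the triangle. -/
noncomputable def normal : Gen → Fin 3 → ℝ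
  | .a => normalA p q
  | .b => normalB p
  | .c => normalC

/-- The order of the product of two distinct generators. -/
def order : Gen → Gen → ℕ
  | .a, .b => q
  | .b, .a => q
  | .b, .c => p
  | .c, .b => p
  -- Meant for the pair `a`, `c` in either order; at equal generators the value is a mere default.
  | _, _ => 2

variable {p q}

theorem gen_mul_self (s : Gen) : gen p q s * gen p q s = 1 := by
  rw [← pow_two]
  have h : ∀ r ∈ relators p q, PresentedGroup.mk (relators p q) r = 1 := fun r hr =>
    PresentedGroup.one_of_mem hr
  cases s
  · exact h (FreeGroup.of Gen.a ^ 2) (by simp [relators])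
  · exact h (FreeGroup.of Gen.b ^ 2) (by simp [relators])
  · exact h (FreeGroup.of Gen.c ^ 2) (by simp [relators])

theorem gen_mul_gen_mul (s : Gen) (g : CoxeterG p q) : gen p q s * (gen p q s * g) = g := by
  rw [← mul_assoc, gen_mul_self, one_mul]

theorem gen_inv (s : Gen) : (gen p q s)⁻¹ = gen p q s :=
  inv_eq_of_mul_eq_one_left (gen_mul_self s)

theorem gen_mul_gen_pow {s t : Gen} (hst : s ≠ t) :
    (gen p q s * gen p q t) ^ order p q s t = 1 := by
  have h : ∀ r ∈ relators p q, PresentedGroup.mk (relators p q) r = 1 := fun r hr =>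
    PresentedGroup.one_of_mem hr
  have hswap : ∀ {s t : Gen} {m : ℕ}, (gen p q s * gen p q t) ^ m = 1 →
      (gen p q t * gen p q s) ^ m = 1 := by
    intro s t m hm
    have : gen p q t * gen p q s = (gen p q s * gen p q t)⁻¹ := by
      rw [mul_inv_rev, gen_inv, gen_inv]
    rw [this, inv_pow, hm, inv_one]
  have hab : (gen p q .a * gen p q .b) ^ q = 1 :=
    h ((FreeGroup.of Gen.a * FreeGroup.of Gen.b) ^ q) (by simp [relators])
  have hac : (gen p q .a * gen p q .c) ^ 2 = 1 :=
    h ((FreeGroup.of Gen.a * FreeGroup.of Gen.c) ^ 2) (by simp [relators])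
  have hbc : (gen p q .b * gen p q .c) ^ p = 1 :=
    h ((FreeGroup.of Gen.b * FreeGroup.of Gen.c) ^ p) (by simp [relators])
  cases s <;> cases t <;> first
    | exact absurd rfl hst
    | assumption
    | exact hswap ‹_›

theorem exists_word (g : CoxeterG p q) : ∃ l : List Gen, (l.map (gen p q)).prod = g := by
  have hg : g ∈ Subgroup.closure (Set.range (gen p q)) := by
    have := PresentedGroup.closure_range_of (relators p q)
    change g ∈ Subgroup.closure (Set.range (PresentedGroup.of (rels := relators p q)))
    rw [this]; trivial
  induction hg using Subgroup.closure_induction with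
  | mem x hx => obtain ⟨s, rfl⟩ := hx; exact ⟨[s], by simp⟩
  | one => exact ⟨[], rfl⟩
  | mul x y _ _ hx hy =>
    obtain ⟨l, rfl⟩ := hx; obtain ⟨m, rfl⟩ := hy
    exact ⟨l ++ m, by simp⟩
  | inv x _ hx =>
    obtain ⟨l, rfl⟩ := hx
    refine ⟨l.reverse, ?_⟩
    rw [List.prod_inv_reverse, List.map_reverse, List.map_map]
    congr 3
    funext s
    exact (gen_inv s).symm

open Classical in
/-- The least number of generators whose product is `g`. -/
noncomputable def wordLength (g : CoxeterG p q) : ℕ :=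
  Nat.find (p := fun n => ∃ l : List Gen, l.length = n ∧ (l.map (gen p q)).prod = g)
    (by obtain ⟨l, hl⟩ := exists_word g; exact ⟨_, l, rfl, hl⟩)

theorem exists_word_length (g : CoxeterG p q) :
    ∃ l : List Gen, l.length = wordLength g ∧ (l.map (gen p q)).prod = g := by
  classical
  exact Nat.find_spec (p := fun n => ∃ l : List Gen, l.length = n ∧ (l.map (gen p q)).prod = g) _

theorem wordLength_le (l : List Gen) : wordLength (l.map (gen p q)).prod ≤ l.length := by
  classical
  exact Nat.find_min' _ ⟨l, rfl, rfl⟩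

theorem wordLength_gen_mul_le (s : Gen) (g : CoxeterG p q) :
    wordLength (gen p q s * g) ≤ wordLength g + 1 := by
  obtain ⟨l, hl, rfl⟩ := exists_word_length g
  rw [← hl]
  simpa using wordLength_le (p := p) (q := q) (s :: l)

theorem exists_wordLength_gen_mul_lt {g : CoxeterG p q} (hg : g ≠ 1) :
    ∃ s, wordLength (gen p q s * g) < wordLength g := by
  obtain ⟨l, hl, rfl⟩ := exists_word_length g
  cases l with
  | nil => simp at hg
  | cons s l =>
    refine ⟨s, ?_⟩
    rw [← hl, List.map_cons, List.prod_cons, gen_mul_gen_mul]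
    exact Nat.lt_succ_of_le (wordLength_le l)

/-! ### Alternating products -/

/-- The product `s t s t ⋯` of the first `k` factors. -/
def altProd (p q : ℕ) (s t : Gen) : ℕ → CoxeterG p q
  | 0 => 1
  | k + 1 => altProd p q s t k * gen p q (if Even k then s else t)

/-- `altProd` grows on the right by definition; growth on the left is needed to multiply a group
element by a generator. -/
theorem gen_mul_altProd (s t : Gen) (k : ℕ) :
    gen p q s * altProd p q t s k = altProd p q s t (k + 1) := by
  induction k with
  | zero => simp [altProd]
  | succ k ih =>
    rw [altProd, ← mul_assoc, ih, altProd]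
    congr 2
    simp only [Nat.even_add_one]
    split_ifs <;> rfl

theorem altProd_two_mul (s t : Gen) (k : ℕ) :
    altProd p q s t (2 * k) = (gen p q s * gen p q t) ^ k := by
  induction k with
  | zero => simp [altProd]
  | succ k ih =>
    rw [show 2 * (k + 1) = 2 * k + 1 + 1 by ring, altProd, altProd, ih, pow_succ]
    simp [mul_assoc]

theorem wordLength_altProd_mul_le (s t : Gen) (k : ℕ) (g : CoxeterG p q) :
    wordLength (altProd p q s t k * g) ≤ k + wordLength g := by
  induction k generalizing g with
  | zero => simp [altProd]
  | succ k ih =>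
    rw [altProd, mul_assoc]
    have h1 := ih (gen p q (if Even k then s else t) * g)
    have h2 := wordLength_gen_mul_le (if Even k then s else t) g
    omega

/-- A long alternating product is shorter when read backwards around the relator. -/
theorem wordLength_altProd_mul_le_sub {s t : Gen} (hst : s ≠ t) (j k : ℕ)
    (hjk : k + j = 2 * order p q s t) (g : CoxeterG p q) :
    wordLength (altProd p q s t k * g) ≤ j + wordLength g := by
  induction j generalizing k g with
  | zero =>
    rw [show k = 2 * order p q s t by omega, altProd_two_mul, gen_mul_gen_pow hst]
    simp
  | succ j ih =>
    -- Replacing `g` by `r (r g)` adds one letter to the alternating product and costs at most one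
    -- unit of word length.
    set r := if Even k then s else t with hr
    have h1 := ih (k + 1) (by omega) (gen p q r * g)
    rw [altProd, mul_assoc, ← hr, gen_mul_gen_mul] at h1
    have h2 := wordLength_gen_mul_le r g
    omega

/-! ### The action on the plane -/

variable [hp : Fact (3 ≤ p)] [hq : Fact (3 ≤ q)]

/-- The value at `x` of the linear form that defines the side `s` of the triangle. -/
noncomputable def height (s : Gen) (x : Space p q) : ℝ := pairing (normal p q s) x.1

theorem mem_triangle {x : Space p q} : x ∈ triangle p q ↔ ∀ s, 0 ≤ height s x := by
  refine ⟨fun h s => ?_, fun h => ⟨h .a, h .b, h .c⟩⟩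
  obtain ⟨ha, hb, hc⟩ := h
  cases s <;> assumption

theorem normalForm_comm (κ : ℝ) (n m : Fin 3 → ℝ) : normalForm κ n m = normalForm κ m n := by
  simp only [normalForm]; ring

theorem normalForm_normal_self (s : Gen) :
    normalForm (curvature p q) (normal p q s) (normal p q s) = 1 := by
  cases s
  exacts [normalForm_aa p q, normalForm_bb p q, normalForm_cc p q]

theorem normalForm_normal {s t : Gen} (hst : s ≠ t) :
    normalForm (curvature p q) (normal p q s) (normal p q t) =
      - Real.cos (Real.pi / order p q s t) := by
  cases s <;> cases t <;> first
    | exact absurd rfl hst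
    | exact normalForm_ab p q
    | exact normalForm_bc p q
    | (rw [normalForm_comm]; first | exact normalForm_ab p q | exact normalForm_bc p q)
    | skip
  · simpa [order, normal] using normalForm_ac p q
  · rw [normalForm_comm]; simpa [order, normal] using normalForm_ac p q

theorem two_le_order (s t : Gen) : 2 ≤ order p q s t := by
  have := hp.out
  have := hq.out
  cases s <;> cases t <;> simp only [order] <;> omega

theorem toPerm_gen (s : Gen) : toPerm p q (gen p q s) =
    lineReflection (normal p q s) (normalForm_normal_self s) := by
  have : toPerm p q (gen p q s) = sideReflection p q s := PresentedGroup.toGroup.of _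
  rw [this]
  cases s <;> rfl

theorem gen_smul_val (s : Gen) (x : Space p q) :
    (gen p q s • x).1 = reflectVec (curvature p q) (normal p q s) x.1 := by
  change (toPerm p q (gen p q s) x).1 = _
  rw [toPerm_gen]; rfl

theorem pairing_reflectVec_of_normal (κ : ℝ) (n m v : Fin 3 → ℝ) :
    pairing n (reflectVec κ m v) = pairing n v - 2 * pairing m v * normalForm κ n m := by
  simp only [pairing, normalForm, reflectVec_zero, reflectVec_one, reflectVec_two]; ring

theorem height_gen_smul_self (s : Gen) (x : Space p q) :
    height s (gen p q s • x) = - height s x := by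
  rw [height, gen_smul_val, pairing_reflectVec (normalForm_normal_self s)]; rfl

theorem height_gen_smul {s t : Gen} (hst : s ≠ t) (x : Space p q) :
    height s (gen p q t • x) =
      height s x + 2 * Real.cos (Real.pi / order p q s t) * height t x := by
  rw [height, gen_smul_val, pairing_reflectVec_of_normal, normalForm_normal hst, height, height]
  ring

theorem gen_smul_eq_self {s : Gen} {x : Space p q} (hx : height s x = 0) :
    gen p q s • x = x := by
  apply Subtype.ext
  rw [gen_smul_val, reflectVec]
  change pairing (normal p q s) x.1 = 0 at hx
  rw [hx]; simp

theorem order_comm (s t : Gen) : order p q s t = order p q t s := by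
  cases s <;> cases t <;> rfl

/-- In the dihedral group of `s` and `t`, the pullback of a simple root is a combination of the two
simple roots with coefficients `sin ((k + 1) θ) / sin θ` and `sin (k θ) / sin θ`. The induction is
the three-term recursion of the sine. -/
theorem sin_mul_height_altProd_smul {s t : Gen} (hst : s ≠ t) (k : ℕ) (x : Space p q) :
    Real.sin (Real.pi / order p q s t) * height s (altProd p q t s k • x) =
      Real.sin ((k + 1) * (Real.pi / order p q s t)) * height (if Even k then s else t) x +
      Real.sin (k * (Real.pi / order p q s t)) * height (if Even k then t else s) x := by
  set θ := Real.pi / order p q s t with hθ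
  induction k generalizing x with
  | zero => simp [altProd]
  | succ k ih =>
    rw [altProd, mul_smul, ih]
    have hsin : Real.sin ((k + 1 + 1) * θ) =
        2 * Real.cos θ * Real.sin ((k + 1) * θ) - Real.sin (k * θ) := by
      have h1 := Real.sin_add ((k + 1) * θ) θ
      have h2 := Real.sin_sub ((k + 1) * θ) θ
      rw [show ((k : ℝ) + 1) * θ + θ = (k + 1 + 1) * θ by ring] at h1
      rw [show ((k : ℝ) + 1) * θ - θ = k * θ by ring] at h2
      rw [h1, h2]; ring
    push_cast
    rw [hsin]
    simp only [Nat.even_add_one]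
    by_cases hk : Even k
    · simp only [hk, if_true, not_true_eq_false, if_false]
      rw [height_gen_smul hst, height_gen_smul_self, ← hθ]; ring
    · simp only [hk, if_true, not_false_eq_true, if_false]
      rw [height_gen_smul hst.symm, height_gen_smul_self, order_comm t s, ← hθ]; ring

/-! ### Position of the triangles relative to the walls -/

/-- If `s g` is not shorter than `g`, then `g` maps the triangle to the positive side of `s`. -/
theorem height_smul_of_wordLength_le (g : CoxeterG p q) (s : Gen)
    (hs : wordLength g ≤ wordLength (gen p q s * g)) (x : Space p q) :
    ((∀ r, 0 ≤ height r x) → 0 ≤ height s (g • x)) ∧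
      ((∀ r, 0 < height r x) → 0 < height s (g • x)) := by
  induction hn : wordLength g using Nat.strong_induction_on generalizing g s with
  | _ n ih =>
  subst hn
  by_cases hg : g = 1
  · subst hg
    rw [one_smul]
    exact ⟨fun h => h s, fun h => h s⟩
  obtain ⟨t, ht⟩ := exists_wordLength_gen_mul_lt hg
  have hst : s ≠ t := by rintro rfl; omega
  set m := order p q s t with hm
  have hm2 : 2 ≤ m := two_le_order s t
  -- the number `k` of letters `t`, `s`, `t`, … that can be split off from the left
  let good : ℕ → Prop := fun k =>
    wordLength ((altProd p q t s k)⁻¹ * g) + k = wordLength g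
  have hge : ∀ k, wordLength g ≤ k + wordLength ((altProd p q t s k)⁻¹ * g) := fun k => by
    simpa using wordLength_altProd_mul_le t s k ((altProd p q t s k)⁻¹ * g)
  have hgood1 : good 1 := by
    have h := hge 1
    have e : (altProd p q t s 1)⁻¹ * g = gen p q t * g := by simp [altProd, gen_inv]
    change wordLength ((altProd p q t s 1)⁻¹ * g) + 1 = wordLength g
    rw [e] at h ⊢
    omega
  -- If `m` letters could be split off, `s g` would begin with `m + 1` alternating letters, which
  -- the relator replaces by `m - 1`, so `s g` would be shorter than `g`.
  have hgoodm : ¬ good m := by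
    intro h
    change wordLength ((altProd p q t s m)⁻¹ * g) + m = wordLength g at h
    have h1 := wordLength_altProd_mul_le_sub hst (m - 1) (m + 1) (by omega)
      ((altProd p q t s m)⁻¹ * g)
    rw [← gen_mul_altProd, mul_assoc, mul_inv_cancel_left] at h1
    omega
  obtain ⟨k, hk1, hkm, hk, hk'⟩ : ∃ k, 1 ≤ k ∧ k < m ∧ good k ∧ ¬ good (k + 1) := by
    by_contra! hcon
    have : ∀ j, 1 ≤ j → j ≤ m → good j := by
      intro j hj
      induction j, hj using Nat.le_induction with
      | base => exact fun _ => hgood1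
      | succ j hj ihj => exact fun h => hcon j hj (by omega) (ihj (by omega))
    exact hgoodm (this m (by omega) le_rfl)
  set v := (altProd p q t s k)⁻¹ * g with hv
  have hgv : g = altProd p q t s k * v := by rw [hv]; group
  change wordLength v + k = wordLength g at hk
  -- By maximality of `k`, the letter that would come next does not shorten `v`.
  have hnext : wordLength v ≤ wordLength (gen p q (if Even k then t else s) * v) := by
    have h := hge (k + 1)
    have e : (altProd p q t s (k + 1))⁻¹ * g = gen p q (if Even k then t else s) * v := by
      rw [altProd, mul_inv_rev, gen_inv, mul_assoc]
    change ¬ (wordLength ((altProd p q t s (k + 1))⁻¹ * g) + (k + 1) = wordLength g) at hk'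
    rw [e] at h hk'
    omega
  -- The letter split off last lengthens `v`, because putting it back undoes the last step. So
  -- neither `s` nor `t` shortens `v`, and induction applies to both.
  have hprev : wordLength v ≤ wordLength (gen p q (if Even k then s else t) * v) := by
    obtain ⟨j, rfl⟩ : ∃ j, k = j + 1 := ⟨k - 1, by omega⟩
    have h := hge j
    have e : (altProd p q t s j)⁻¹ * g = gen p q (if Even (j + 1) then s else t) * v := by
      rw [hv, altProd, mul_inv_rev, gen_inv]
      simp only [Nat.even_add_one]
      by_cases hj : Even j <;> simp [hj, mul_assoc, gen_mul_gen_mul]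
    rw [e] at h
    omega
  have h1 := ih (wordLength v) (by omega) v _ hprev rfl
  have h2 := ih (wordLength v) (by omega) v _ hnext rfl
  have hsin := sin_mul_height_altProd_smul hst k (v • x)
  rw [← mul_smul, ← hgv, ← hm] at hsin
  have hm0 : (0 : ℝ) < m := by positivity
  have hpi := Real.pi_pos
  have hbound : ∀ j : ℕ, 1 ≤ j → j < m → 0 < Real.sin (j * (Real.pi / m)) := by
    intro j hj1 hjm
    have hj0 : (0 : ℝ) < j := by exact_mod_cast hj1
    have hjm' : (j : ℝ) < m := by exact_mod_cast hjm
    refine Real.sin_pos_of_pos_of_lt_pi (by positivity) ?_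
    rw [← mul_div_assoc, div_lt_iff₀ hm0]
    nlinarith
  have hk0 := hbound k hk1 hkm
  have h10 : 0 < Real.sin (Real.pi / m) := by simpa using hbound 1 le_rfl (by omega)
  -- This coefficient vanishes for `k + 1 = m`; strict positivity has to come from the other term,
  -- whose coefficient satisfies `1 ≤ k < m`.
  have hk2 : 0 ≤ Real.sin (((k : ℝ) + 1) * (Real.pi / m)) := by
    rcases (show k + 1 ≤ m from hkm).lt_or_eq with h | h
    · exact_mod_cast (hbound (k + 1) (by omega) h).le
    · have : ((k : ℝ) + 1) = m := by exact_mod_cast h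
      rw [this, mul_div_cancel₀ _ hm0.ne', Real.sin_pi]
  constructor
  · intro hx
    refine nonneg_of_mul_nonneg_right (b := height s (g • x)) ?_ h10
    rw [hsin]
    exact add_nonneg (mul_nonneg hk2 (h1.1 hx)) (mul_nonneg hk0.le (h2.1 hx))
  · intro hx
    refine pos_of_mul_pos_right (b := height s (g • x)) ?_ h10.le
    rw [hsin]
    exact add_pos_of_nonneg_of_pos (mul_nonneg hk2 (h1.2 hx).le) (mul_pos hk0 (h2.2 hx))

/-- The previous theorem applied to `s g`, followed by the reflection `s`, which changes the sign of
the height. -/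
theorem height_smul_of_wordLength_lt {g : CoxeterG p q} {s : Gen}
    (hs : wordLength (gen p q s * g) < wordLength g) (x : Space p q) :
    ((∀ r, 0 ≤ height r x) → height s (g • x) ≤ 0) ∧
      ((∀ r, 0 < height r x) → height s (g • x) < 0) := by
  have h := height_smul_of_wordLength_le (gen p q s * g) s
    (by rw [gen_mul_gen_mul]; exact hs.le) x
  rw [mul_smul, height_gen_smul_self] at h
  exact ⟨fun hx => by linarith [h.1 hx], fun hx => by linarith [h.2 hx]⟩

/-- Only the identity maps an interior point of the triangle into the triangle. -/
theorem eq_one_of_smul_mem_triangle {g : CoxeterG p q} {x : Space p q}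
    (hx : ∀ r, 0 < height r x) (hgx : g • x ∈ triangle p q) : g = 1 := by
  by_contra hg
  obtain ⟨s, hs⟩ := exists_wordLength_gen_mul_lt hg
  exact absurd (mem_triangle.1 hgx s) ((height_smul_of_wordLength_lt hs x).2 hx).not_ge

/-- The stabiliser of a point of the triangle is generated by the reflections that fix it. -/
theorem mem_of_smul_eq_self {x : Space p q} (hx : x ∈ triangle p q)
    (D : Subgroup (CoxeterG p q)) (hD : ∀ s, height s x = 0 → gen p q s ∈ D)
    {g : CoxeterG p q} (hg : g • x = x) : g ∈ D := by
  induction hn : wordLength g using Nat.strong_induction_on generalizing g with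
  | _ n ih =>
  subst hn
  by_cases h1 : g = 1
  · rw [h1]; exact D.one_mem
  obtain ⟨s, hs⟩ := exists_wordLength_gen_mul_lt h1
  have h0 := (height_smul_of_wordLength_lt hs x).1 (mem_triangle.1 hx)
  rw [hg] at h0
  have hsx : height s x = 0 := le_antisymm h0 (mem_triangle.1 hx s)
  have hmem := ih _ hs (g := gen p q s * g) (by rw [mul_smul, hg, gen_smul_eq_self hsx]) rfl
  simpa [gen_mul_gen_mul] using D.mul_mem (hD s hsx) hmem

end Tits

/-! ### Squared chord distances -/

section Distance

/-- The value of `normalForm κ` at `x - y`: the square of the length of the chord from `x` to `y`. -/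
def sqDist (κ : ℝ) (x y : Fin 3 → ℝ) : ℝ := normalForm κ (x - y) (x - y)

theorem sqDist_eq (κ : ℝ) (x y : Fin 3 → ℝ) :
    sqDist κ x y = (x 0 - y 0) ^ 2 + (x 1 - y 1) ^ 2 + κ * (x 2 - y 2) ^ 2 := by
  simp only [sqDist, normalForm, Pi.sub_apply]; ring

theorem sqDist_comm (κ : ℝ) (x y : Fin 3 → ℝ) : sqDist κ x y = sqDist κ y x := by
  simp only [sqDist_eq]; ring

theorem Plane.two_eq_one (x : Plane 0) : x.1 2 = 1 := by
  have h1 := x.2.1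
  have h2 := x.2.2 le_rfl
  nlinarith

/-- The reversed Cauchy-Schwarz inequality on the hyperboloid. The identity `key` exhibits the
defect as a sum of squares, which also settles equality. -/
theorem one_le_lorentz (x y : Plane (-1)) :
    1 ≤ x.1 2 * y.1 2 - x.1 0 * y.1 0 - x.1 1 * y.1 1 ∧
      (x.1 2 * y.1 2 - x.1 0 * y.1 0 - x.1 1 * y.1 1 = 1 → x = y) := by
  have hx := x.2.1
  have hy := y.2.1
  have hx0 := x.2.2 (by norm_num)
  have hy0 := y.2.2 (by norm_num)
  have hpos := mul_pos hx0 hy0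
  set d := x.1 0 * y.1 0 + x.1 1 * y.1 1 with hd
  have key : (x.1 2 * y.1 2) ^ 2 = (1 + d) ^ 2 + ((x.1 0 - y.1 0) ^ 2 + (x.1 1 - y.1 1) ^ 2) +
      (x.1 0 * y.1 1 - x.1 1 * y.1 0) ^ 2 := by
    rw [mul_pow, show x.1 2 ^ 2 = 1 + (x.1 0 ^ 2 + x.1 1 ^ 2) by linarith,
      show y.1 2 ^ 2 = 1 + (y.1 0 ^ 2 + y.1 1 ^ 2) by linarith, hd]
    ring
  constructor
  · have : 1 + d ≤ x.1 2 * y.1 2 := by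
      refine le_of_sq_le_sq ?_ hpos.le
      rw [key]; nlinarith [sq_nonneg (x.1 0 - y.1 0), sq_nonneg (x.1 1 - y.1 1),
        sq_nonneg (x.1 0 * y.1 1 - x.1 1 * y.1 0)]
    linarith
  · intro h
    have h' : x.1 2 * y.1 2 = 1 + d := by linarith
    rw [h'] at key
    have h0 : (x.1 0 - y.1 0) ^ 2 = 0 := by
      nlinarith [sq_nonneg (x.1 0 - y.1 0), sq_nonneg (x.1 1 - y.1 1),
        sq_nonneg (x.1 0 * y.1 1 - x.1 1 * y.1 0)]
    have h1 : (x.1 1 - y.1 1) ^ 2 = 0 := by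
      nlinarith [sq_nonneg (x.1 0 - y.1 0), sq_nonneg (x.1 1 - y.1 1),
        sq_nonneg (x.1 0 * y.1 1 - x.1 1 * y.1 0)]
    have e0 : x.1 0 = y.1 0 := sub_eq_zero.1 (pow_eq_zero_iff two_ne_zero |>.1 h0)
    have e1 : x.1 1 = y.1 1 := sub_eq_zero.1 (pow_eq_zero_iff two_ne_zero |>.1 h1)
    have e2 : x.1 2 = y.1 2 := by
      have : x.1 2 ^ 2 = y.1 2 ^ 2 := by rw [e0, e1] at hx; linarith
      exact (pow_left_inj₀ hx0.le hy0.le two_ne_zero).1 this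
    apply Subtype.ext
    funext i
    fin_cases i <;> assumption

variable {κ : ℝ}

/-- For `κ = ±1` the linear reflection preserves `normalForm`, as `κ² = 1`. For `κ = 0` this is true
only of points at height `1`: there the coefficient `n 2` cancels from the difference of the two
pairings. -/
theorem sqDist_reflectVec (hκ : κ = 1 ∨ κ = 0 ∨ κ = -1) {n : Fin 3 → ℝ}
    (hn : normalForm κ n n = 1) (x y : Plane κ) :
    sqDist κ (reflectVec κ n x.1) (reflectVec κ n y.1) = sqDist κ x.1 y.1 := by
  simp only [sqDist_eq, reflectVec_zero, reflectVec_one, reflectVec_two]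
  simp only [normalForm] at hn
  rcases hκ with rfl | rfl | rfl
  · simp only [pairing]
    linear_combination 4 * (n 0 * (x.1 0 - y.1 0) + n 1 * (x.1 1 - y.1 1) +
      n 2 * (x.1 2 - y.1 2)) ^ 2 * hn
  · simp only [pairing, x.two_eq_one, y.two_eq_one]
    linear_combination 4 * (n 0 * (x.1 0 - y.1 0) + n 1 * (x.1 1 - y.1 1)) ^ 2 * hn
  · simp only [pairing]
    linear_combination 4 * (n 0 * (x.1 0 - y.1 0) + n 1 * (x.1 1 - y.1 1) +
      n 2 * (x.1 2 - y.1 2)) ^ 2 * hn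

theorem sqDist_sphere (x y : Plane 1) :
    sqDist 1 x.1 y.1 = 2 - 2 * (x.1 0 * y.1 0 + x.1 1 * y.1 1 + x.1 2 * y.1 2) := by
  have hx := x.2.1
  have hy := y.2.1
  rw [sqDist_eq]; linarith

theorem sqDist_hyperbolic (x y : Plane (-1)) :
    sqDist (-1) x.1 y.1 = 2 * (x.1 2 * y.1 2 - x.1 0 * y.1 0 - x.1 1 * y.1 1) - 2 := by
  have hx := x.2.1
  have hy := y.2.1
  rw [sqDist_eq]; linarith

/-- For the three curvatures, distances and chord lengths determine each other. -/
theorem planeDist_eq_iff (hκ : κ = 1 ∨ κ = 0 ∨ κ = -1) (x y x' y' : Plane κ) :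
    planeDist x y = planeDist x' y' ↔ sqDist κ x.1 y.1 = sqDist κ x'.1 y'.1 := by
  rcases hκ with rfl | rfl | rfl
  · have hmem : ∀ x y : Plane 1, x.1 0 * y.1 0 + x.1 1 * y.1 1 + x.1 2 * y.1 2 ∈
        Set.Icc (-1 : ℝ) 1 := by
      intro x y
      have hx := x.2.1
      have hy := y.2.1
      constructor
      · nlinarith [sq_nonneg (x.1 0 + y.1 0), sq_nonneg (x.1 1 + y.1 1), sq_nonneg (x.1 2 + y.1 2)]
      · nlinarith [sq_nonneg (x.1 0 - y.1 0), sq_nonneg (x.1 1 - y.1 1), sq_nonneg (x.1 2 - y.1 2)]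
    rw [sqDist_sphere, sqDist_sphere]
    simp only [planeDist, zero_lt_one, if_true]
    rw [Real.arccos_injOn.eq_iff (hmem x y) (hmem x' y')]
    constructor <;> intro h <;> linarith
  · simp only [planeDist, lt_irrefl, if_false, if_true]
    rw [Real.sqrt_inj (by positivity) (by positivity), sqDist_eq, sqDist_eq]
    simp
  · rw [sqDist_hyperbolic, sqDist_hyperbolic]
    simp only [planeDist, show ¬ (0 : ℝ) < -1 by norm_num, show ¬ (-1 : ℝ) = 0 by norm_num, if_false]
    have h1 := (one_le_lorentz x y).1
    have h2 := (one_le_lorentz x' y').1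
    rw [Real.arcosh_injOn.eq_iff h1 h2]
    constructor <;> intro h <;> linarith

theorem sqDist_nonneg (hκ : κ = 1 ∨ κ = 0 ∨ κ = -1) (x y : Plane κ) : 0 ≤ sqDist κ x.1 y.1 := by
  rcases hκ with rfl | rfl | rfl
  · rw [sqDist_eq]; positivity
  · rw [sqDist_eq]; positivity
  · rw [sqDist_hyperbolic]; linarith [(one_le_lorentz x y).1]

theorem eq_of_sqDist_eq_zero (hκ : κ = 1 ∨ κ = 0 ∨ κ = -1) {x y : Plane κ}
    (h : sqDist κ x.1 y.1 = 0) : x = y := by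
  have hext : x.1 0 = y.1 0 → x.1 1 = y.1 1 → x.1 2 = y.1 2 → x = y := by
    intro h0 h1 h2
    apply Subtype.ext
    funext i
    fin_cases i <;> assumption
  rcases hκ with rfl | rfl | rfl
  · rw [sqDist_eq] at h
    refine hext ?_ ?_ ?_ <;> refine sub_eq_zero.1 (pow_eq_zero_iff two_ne_zero |>.1 ?_) <;>
      nlinarith [sq_nonneg (x.1 0 - y.1 0), sq_nonneg (x.1 1 - y.1 1), sq_nonneg (x.1 2 - y.1 2)]
  · rw [sqDist_eq] at h
    refine hext ?_ ?_ (by rw [x.two_eq_one, y.two_eq_one]) <;>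
      refine sub_eq_zero.1 (pow_eq_zero_iff two_ne_zero |>.1 ?_) <;>
      nlinarith [sq_nonneg (x.1 0 - y.1 0), sq_nonneg (x.1 1 - y.1 1)]
  · rw [sqDist_hyperbolic] at h
    exact (one_le_lorentz x y).2 (by linarith)

/-- Two points of the plane have the same norm, unless the plane is Euclidean. -/
theorem normalForm_self_eq (hκ : κ = 1 ∨ κ = -1) (x y : Plane κ) :
    normalForm κ x.1 x.1 = normalForm κ y.1 y.1 := by
  have hx := x.2.1
  have hy := y.2.1
  simp only [normalForm]
  rcases hκ with rfl | rfl <;> linarith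

/-- The linear form that vanishes at the points with equal distances to `y` and `z`. -/
def bisector (κ : ℝ) (y z : Fin 3 → ℝ) : Fin 3 → ℝ :=
  ![2 * (y 0 - z 0), 2 * (y 1 - z 1),
    2 * κ * (y 2 - z 2) - (normalForm κ y y - normalForm κ z z)]

/-- The constant term of the affine bisector equation is attached to the coordinate `x 2`. This is
exact for `κ = 0`, where `x 2 = 1`, and harmless otherwise, where all points have the same norm and
the term is zero. -/
theorem pairing_bisector (hκ : κ = 1 ∨ κ = 0 ∨ κ = -1) (x y z : Plane κ) :
    pairing (bisector κ y.1 z.1) x.1 = sqDist κ x.1 z.1 - sqDist κ x.1 y.1 := by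
  have h : pairing (bisector κ y.1 z.1) x.1 = sqDist κ x.1 z.1 - sqDist κ x.1 y.1 +
      (normalForm κ y.1 y.1 - normalForm κ z.1 z.1) * (1 - x.1 2) := by
    simp [pairing, bisector, sqDist_eq, normalForm]; ring
  have h0 : (normalForm κ y.1 y.1 - normalForm κ z.1 z.1) * (1 - x.1 2) = 0 := by
    rcases hκ with rfl | rfl | rfl
    · rw [normalForm_self_eq (Or.inl rfl) y z]; ring
    · rw [x.two_eq_one]; ring
    · rw [normalForm_self_eq (Or.inr rfl) y z]; ring
  rw [h, h0, add_zero]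

/-- If the bisector of `y` and `z` is a multiple of the line with unit normal `n`, then `z` is `y`
or the mirror image of `y`. -/
theorem eq_or_eq_reflectVec (hκ : κ = 1 ∨ κ = 0 ∨ κ = -1) {n : Fin 3 → ℝ}
    (hn : normalForm κ n n = 1) (y z : Plane κ) (c : ℝ) (h : bisector κ y.1 z.1 = c • n) :
    z = y ∨ z.1 = reflectVec κ n y.1 := by
  have e0 : 2 * (y.1 0 - z.1 0) = c * n 0 := by simpa [bisector] using congrFun h 0
  have e1 : 2 * (y.1 1 - z.1 1) = c * n 1 := by simpa [bisector] using congrFun h 1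
  have e2 : 2 * (y.1 2 - z.1 2) = c * (κ * n 2) := by
    have : 2 * κ * (y.1 2 - z.1 2) - (normalForm κ y.1 y.1 - normalForm κ z.1 z.1) = c * n 2 := by
      simpa [bisector] using congrFun h 2
    rcases hκ with rfl | rfl | rfl
    · rw [normalForm_self_eq (Or.inl rfl) y z] at this; linarith
    · rw [y.two_eq_one, z.two_eq_one]; ring
    · rw [normalForm_self_eq (Or.inr rfl) y z] at this; linarith
  have hpair : ∀ x : Plane κ, c * pairing n x.1 = sqDist κ x.1 z.1 - sqDist κ x.1 y.1 := by
    intro x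
    rw [← pairing_bisector hκ, h]
    simp [pairing]; ring
  have hself : ∀ x : Plane κ, sqDist κ x.1 x.1 = 0 := fun x => by simp [sqDist_eq]
  have hy := hpair y
  have hz := hpair z
  rw [hself, sub_zero] at hy
  rw [hself, sqDist_comm] at hz
  -- With `D` the squared chord from `y` to `z`, `hy` and `hz` say that `c` times the pairings with
  -- `y` and `z` is `D` and `-D`. Since `n` is a unit normal, `c` is either `0` or four times the
  -- pairing with `y`, and the latter is the reflection formula.
  have hsub : 2 * (pairing n y.1 - pairing n z.1) = c := by
    have : 2 * (pairing n y.1 - pairing n z.1) = c * normalForm κ n n := by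
      simp only [pairing, normalForm]; linear_combination n 0 * e0 + n 1 * e1 + n 2 * e2
    rw [this, hn, mul_one]
  rcases eq_or_ne c 0 with rfl | hc
  · left
    exact (eq_of_sqDist_eq_zero hκ (by rw [← hy]; ring)).symm
  · right
    have hneg : pairing n z.1 = - pairing n y.1 := mul_left_cancel₀ hc (by linarith)
    have hc' : c = 4 * pairing n y.1 := by rw [← hsub, hneg]; ring
    rw [hc'] at e0 e1 e2
    funext i
    fin_cases i
    · change z.1 0 = reflectVec κ n y.1 0
      rw [reflectVec_zero]; linarith
    · change z.1 1 = reflectVec κ n y.1 1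
      rw [reflectVec_one]; linarith
    · change z.1 2 = reflectVec κ n y.1 2
      rw [reflectVec_two]; linarith

end Distance

/-! ### The vertices of the triangle -/

section Vertices

variable {p q : ℕ}

theorem curvature_cases : curvature p q = 1 ∨ curvature p q = 0 ∨ curvature p q = -1 := by
  unfold curvature
  split_ifs <;> simp

theorem curvature_eq_zero_of_cos_eq_sin (hp : 3 ≤ p) (hq : 3 ≤ q)
    (h : Real.cos (Real.pi / q) = Real.sin (Real.pi / p)) : curvature p q = 0 := by
  obtain ⟨hp1, hp2⟩ := pi_div_bounds p hp
  obtain ⟨hq1, hq2⟩ := pi_div_bounds q hq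
  rw [← Real.sin_pi_div_two_sub] at h
  have h' := Real.injOn_sin ⟨by linarith, by linarith⟩ ⟨by linarith, by linarith⟩ h
  have hsum : (1 / p + 1 / q : ℝ) = 1 / 2 := by
    have hpi := Real.pi_pos
    have : Real.pi * (1 / p + 1 / q : ℝ) = Real.pi * (1 / 2) := by
      rw [mul_add, mul_one_div, mul_one_div, mul_one_div]; linarith
    exact mul_left_cancel₀ hpi.ne' this
  rw [curvature, if_neg (by rw [hsum]; exact lt_irrefl _), if_pos hsum]

variable [hp : Fact (3 ≤ p)] [hq : Fact (3 ≤ q)]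

theorem cos_pi_div_pos (n : ℕ) (hn : 3 ≤ n) : 0 < Real.cos (Real.pi / n) := by
  obtain ⟨h1, h2⟩ := pi_div_bounds n hn
  exact Real.cos_pos_of_mem_Ioo ⟨by linarith [Real.pi_pos], h2⟩

theorem normalAx_mul_sin : normalAx p q * Real.sin (Real.pi / p) = - Real.cos (Real.pi / q) := by
  have := (sin_pi_div_pos p hp.out).ne'
  rw [normalAx]; field_simp

/-- The square root could vanish only for `normalAx p q = -1`, which forces the Euclidean case,
where the value is `1` by definition. -/
theorem normalAz_pos : 0 < normalAz p q := by
  rw [normalAz]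
  split_ifs with h
  · exact one_pos
  · refine Real.sqrt_pos.2 (abs_pos.2 fun h0 => h ?_)
    have hs := sin_pi_div_pos p hp.out
    have hx : normalAx p q = -1 := by nlinarith [normalAx_neg p q]
    have := normalAx_mul_sin (p := p) (q := q)
    rw [hx] at this
    exact curvature_eq_zero_of_cos_eq_sin hp.out hq.out (by linarith)

variable (p q) in
/-- The vertex of the triangle opposite to the side `s`. -/
noncomputable def vert : Gen → Space p q
  | .a => faceCentre p q
  | .b => edgeMidpoint p q
  | .c => vertexPoint p q

theorem height_vert_self_pos (s : Gen) : 0 < height s (vert p q s) := by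
  have hz := normalAz_pos (p := p) (q := q)
  have hs := sin_pi_div_pos p hp.out
  have hs' := sin_pi_div_pos q hq.out
  cases s
  · simpa [height, vert, pairing, normal, normalA, faceCentre] using hz
  · simpa [height, vert, pairing, normal, normalB, edgeMidpoint] using mul_pos hs hz
  · simpa [height, vert, pairing, normal, normalC, vertexPoint] using
      mul_pos (inv_pos.2 hs') (mul_pos hz hs)

theorem height_vert {s t : Gen} (hst : s ≠ t) : height s (vert p q t) = 0 := by
  cases s <;> cases t <;> first
    | exact absurd rfl hst
    | skip
  all_goals
    simp [height, vert, pairing, normal, normalA, normalB, normalC, faceCentre, edgeMidpoint,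
      vertexPoint]
  all_goals ring

theorem vert_mem_triangle (s : Gen) : vert p q s ∈ triangle p q := by
  refine mem_triangle.2 fun r => ?_
  by_cases h : r = s
  · rw [h]; exact (height_vert_self_pos s).le
  · exact (height_vert h).ge

theorem eq_sum_vert_abc (x : Fin 3 → ℝ) :
    x = (pairing (normal p q .a) x / height .a (vert p q .a)) • (vert p q .a).1 +
      (pairing (normal p q .b) x / height .b (vert p q .b)) • (vert p q .b).1 +
      (pairing (normal p q .c) x / height .c (vert p q .c)) • (vert p q .c).1 := by
  have hz := (normalAz_pos (p := p) (q := q)).ne'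
  have hs := (sin_pi_div_pos p hp.out).ne'
  have hs' := (sin_pi_div_pos q hq.out).ne'
  funext i
  fin_cases i <;>
    simp [height, vert, pairing, normal, normalA, normalB, normalC, faceCentre, edgeMidpoint,
      vertexPoint] <;> field_simp <;> ring

/-- The vertices of the triangle form a basis; the coordinates are given by the heights. -/
theorem eq_sum_vert {s t u : Gen} (hst : s ≠ t) (hsu : s ≠ u) (htu : t ≠ u) (x : Fin 3 → ℝ) :
    x = (pairing (normal p q s) x / height s (vert p q s)) • (vert p q s).1 +
      (pairing (normal p q t) x / height t (vert p q t)) • (vert p q t).1 +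
      (pairing (normal p q u) x / height u (vert p q u)) • (vert p q u).1 := by
  have h := eq_sum_vert_abc (p := p) (q := q) x
  cases s <;> cases t <;> cases u <;> first
    | exact absurd rfl hst
    | exact absurd rfl hsu
    | exact absurd rfl htu
    | (refine h.trans ?_; abel)

theorem pairing_eq_sum_vert {s t u : Gen} (hst : s ≠ t) (hsu : s ≠ u) (htu : t ≠ u)
    (n x : Fin 3 → ℝ) :
    pairing n x = pairing (normal p q s) x / height s (vert p q s) * pairing n (vert p q s).1 +
      pairing (normal p q t) x / height t (vert p q t) * pairing n (vert p q t).1 +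
      pairing (normal p q u) x / height u (vert p q u) * pairing n (vert p q u).1 := by
  have h := congrArg (pairing n) (eq_sum_vert (p := p) (q := q) hst hsu htu x)
  refine h.trans ?_
  simp only [pairing, Pi.add_apply, Pi.smul_apply, smul_eq_mul]
  ring

theorem pairing_ext {n m : Fin 3 → ℝ} (h : ∀ x, pairing n x = pairing m x) : n = m := by
  funext i
  have := h (Pi.single i 1)
  fin_cases i <;> simpa [pairing] using this

/-- A point with the same distances to two vertices as the point `y` is `y` or its mirror image. -/
theorem eq_or_eq_gen_smul {s t u : Gen} (hst : s ≠ t) (hsu : s ≠ u) (htu : t ≠ u) {y z : Space p q}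
    (ht : sqDist (curvature p q) (vert p q t).1 z.1 = sqDist (curvature p q) (vert p q t).1 y.1)
    (hu : sqDist (curvature p q) (vert p q u).1 z.1 = sqDist (curvature p q) (vert p q u).1 y.1) :
    z = y ∨ z = gen p q s • y := by
  have hκ := curvature_cases (p := p) (q := q)
  set n := bisector (curvature p q) y.1 z.1 with hn
  have hnt : pairing n (vert p q t).1 = 0 := by rw [hn, pairing_bisector hκ, ht, sub_self]
  have hnu : pairing n (vert p q u).1 = 0 := by rw [hn, pairing_bisector hκ, hu, sub_self]
  -- A linear form that vanishes at the vertices `t` and `u` is a multiple of the form that defines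
  -- their line.
  have hmul : n = (pairing n (vert p q s).1 / height s (vert p q s)) • normal p q s := by
    refine pairing_ext fun x => ?_
    rw [pairing_eq_sum_vert (p := p) (q := q) hst hsu htu n x, hnt, hnu]
    simp only [pairing, Pi.smul_apply, smul_eq_mul]
    ring
  rcases eq_or_eq_reflectVec hκ (normalForm_normal_self s) y z _ hmul with h | h
  · exact Or.inl h
  · exact Or.inr (Subtype.ext (h.trans (gen_smul_val s y).symm))

/-- A point is determined by its distances to the three vertices. -/
theorem eq_of_sqDist_vert {y z : Space p q}
    (h : ∀ s, sqDist (curvature p q) (vert p q s).1 z.1 =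
      sqDist (curvature p q) (vert p q s).1 y.1) : z = y := by
  have hκ := curvature_cases (p := p) (q := q)
  have h0 : ∀ s, pairing (bisector (curvature p q) y.1 z.1) (vert p q s).1 = 0 := fun s => by
    rw [pairing_bisector hκ, h s, sub_self]
  -- The bisector form vanishes on a basis, hence also at `y`, where its value is the squared chord
  -- from `y` to `z`.
  have hy := pairing_bisector hκ y y z
  rw [pairing_eq_sum_vert (p := p) (q := q) (s := .a) (t := .b) (u := .c) (by simp) (by simp) (by simp), h0, h0,
    h0] at hy
  refine (eq_of_sqDist_eq_zero hκ ?_).symm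
  have hself : sqDist (curvature p q) y.1 y.1 = 0 := by simp [sqDist_eq]
  rw [hself] at hy
  linarith

/-! ### The group acts by isometries -/

theorem gen_mem_isometryGroup (s : Gen) :
    toPerm p q (gen p q s) ∈ isometryGroup (curvature p q) := by
  intro x y
  rw [planeDist_eq_iff curvature_cases, toPerm_gen]
  exact sqDist_reflectVec curvature_cases (normalForm_normal_self s) x y

theorem toPerm_mem_isometryGroup (g : CoxeterG p q) :
    toPerm p q g ∈ isometryGroup (curvature p q) := by
  obtain ⟨l, rfl⟩ := exists_word g
  induction l with
  | nil => simp
  | cons s l ih =>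
    rw [List.map_cons, List.prod_cons, map_mul]
    exact Subgroup.mul_mem _ (gen_mem_isometryGroup s) ih

theorem sqDist_of_mem_isometryGroup {f : Equiv.Perm (Space p q)}
    (hf : f ∈ isometryGroup (curvature p q)) (x y : Space p q) :
    sqDist (curvature p q) (f x).1 (f y).1 = sqDist (curvature p q) x.1 y.1 :=
  (planeDist_eq_iff curvature_cases _ _ _ _).1 (hf x y)

theorem sqDist_smul (g : CoxeterG p q) (x y : Space p q) :
    sqDist (curvature p q) (g • x).1 (g • y).1 = sqDist (curvature p q) x.1 y.1 :=
  sqDist_of_mem_isometryGroup (toPerm_mem_isometryGroup g) x y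

/-- An isometry that fixes two vertices is the identity or the reflection in their line. -/
theorem eq_one_or_eq_gen {s t u : Gen} (hst : s ≠ t) (hsu : s ≠ u) (htu : t ≠ u)
    {f : Equiv.Perm (Space p q)} (hf : f ∈ isometryGroup (curvature p q))
    (ht : f (vert p q t) = vert p q t) (hu : f (vert p q u) = vert p q u) :
    f = 1 ∨ f = toPerm p q (gen p q s) := by
  have hid : ∀ f ∈ isometryGroup (curvature p q), f (vert p q s) = vert p q s →
      f (vert p q t) = vert p q t → f (vert p q u) = vert p q u → f = 1 := by
    intro f hf hs ht hu
    ext1 x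
    refine eq_of_sqDist_vert fun r => ?_
    have hr : f (vert p q r) = vert p q r := by
      have : r = s ∨ r = t ∨ r = u := by cases r <;> cases s <;> cases t <;> cases u <;> simp_all
      rcases this with rfl | rfl | rfl <;> assumption
    have := sqDist_of_mem_isometryGroup hf (vert p q r) x
    rwa [hr] at this
  have h1 := sqDist_of_mem_isometryGroup hf (vert p q t) (vert p q s)
  have h2 := sqDist_of_mem_isometryGroup hf (vert p q u) (vert p q s)
  rw [ht] at h1
  rw [hu] at h2
  rcases eq_or_eq_gen_smul hst hsu htu h1 h2 with h | h
  · exact Or.inl (hid f hf h ht hu)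
  · right
    have hsmul : ∀ x, (toPerm p q (gen p q s) * f) x = gen p q s • f x := fun x => rfl
    have h3 := hid (toPerm p q (gen p q s) * f)
      (Subgroup.mul_mem _ (gen_mem_isometryGroup s) hf)
      (by rw [hsmul, h, ← mul_smul, gen_mul_self, one_smul])
      (by rw [hsmul, ht, gen_smul_eq_self (height_vert hst)])
      (by rw [hsmul, hu, gen_smul_eq_self (height_vert hsu)])
    rw [eq_inv_of_mul_eq_one_right h3, ← map_inv, gen_inv]

/-! ### The farthest points of a tile from its centre -/

end Vertices

/-- For `κ = ±1`, expand the quadric equation at `X`, with `1 - κ d / 2` as the product of two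
points at squared chord `d`. For `κ = 0` it says that the coefficients are barycentric. -/
theorem sum_sq_sub_one_of_eq_combination {κ : ℝ} (hκ : κ = 1 ∨ κ = 0 ∨ κ = -1) (A B C X : Plane κ)
    {α β γ : ℝ} (hX : X.1 = α • A.1 + β • B.1 + γ • C.1) :
    (α + β + γ) ^ 2 - 1 = κ * (α * β * sqDist κ A.1 B.1 + α * γ * sqDist κ C.1 A.1 +
      β * γ * sqDist κ C.1 B.1) := by
  have hA := A.2.1
  have hB := B.2.1
  have hC := C.2.1
  have hX' := X.2.1
  have h : ∀ i, X.1 i = α * A.1 i + β * B.1 i + γ * C.1 i := fun i => by rw [hX]; simp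
  rw [h, h, h] at hX'
  rcases hκ with rfl | rfl | rfl
  · simp only [sqDist_eq]
    linear_combination hX' - α * (α + β + γ) * hA - β * (α + β + γ) * hB - γ * (α + β + γ) * hC
  · have h2 := h 2
    rw [A.two_eq_one, B.two_eq_one, C.two_eq_one, X.two_eq_one] at h2
    linear_combination -(α + β + γ + 1) * h2
  · simp only [sqDist_eq]
    linear_combination hX' - α * (α + β + γ) * hA - β * (α + β + γ) * hB - γ * (α + β + γ) * hC

/-- A Stewart-type formula. In the curved cases the distance contains `2 κ (1 - σ)`, where `σ` is
the sum of the coefficients; multiplying by `1 + σ` turns this into the quadratic expression of the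
previous lemma and matches the Euclidean formula, where `σ = 1`. -/
theorem sqDist_of_eq_combination {κ : ℝ} (hκ : κ = 1 ∨ κ = 0 ∨ κ = -1) (A B C X : Plane κ)
    {α β γ : ℝ} (hX : X.1 = α • A.1 + β • B.1 + γ • C.1) :
    (1 + (α + β + γ)) * sqDist κ C.1 X.1 =
      (1 + (α + β + γ)) * (α * sqDist κ C.1 A.1 + β * sqDist κ C.1 B.1) -
      2 * (α * β * sqDist κ A.1 B.1 + α * γ * sqDist κ C.1 A.1 + β * γ * sqDist κ C.1 B.1) := by
  have hS := sum_sq_sub_one_of_eq_combination hκ A B C X hX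
  have h : ∀ i, X.1 i = α * A.1 i + β * B.1 i + γ * C.1 i := fun i => by rw [hX]; simp
  have hA := A.2.1
  have hB := B.2.1
  have hC := C.2.1
  have hX' := X.2.1
  rcases hκ with rfl | rfl | rfl
  · have : sqDist 1 C.1 X.1 =
        2 * (1 - (α + β + γ)) + α * sqDist 1 C.1 A.1 + β * sqDist 1 C.1 B.1 := by
      rw [sqDist_sphere, sqDist_sphere, sqDist_sphere, h, h, h]
      linear_combination (-2) * γ * hC
    linear_combination (1 + (α + β + γ)) * this - 2 * hS
  · have h2 := h 2
    rw [A.two_eq_one, B.two_eq_one, C.two_eq_one, X.two_eq_one] at h2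
    have hγ : γ = 1 - α - β := by linarith
    subst hγ
    simp only [sqDist_eq]
    rw [h, h]
    ring
  · have : sqDist (-1) C.1 X.1 =
        -2 * (1 - (α + β + γ)) + α * sqDist (-1) C.1 A.1 + β * sqDist (-1) C.1 B.1 := by
      rw [sqDist_hyperbolic, sqDist_hyperbolic, sqDist_hyperbolic, h, h, h]
      linear_combination 2 * γ * hC
    linear_combination (1 + (α + β + γ)) * this + 2 * hS

section Tile

variable {p q : ℕ} [hp : Fact (3 ≤ p)] [hq : Fact (3 ≤ q)]

/-- In the triangle, the vertex `t` is the unique point that is farthest from the vertex `u`. -/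
theorem sqDist_vert_le {s t u : Gen} (hst : s ≠ t) (hsu : s ≠ u) (htu : t ≠ u)
    (hlt : sqDist (curvature p q) (vert p q u).1 (vert p q s).1 <
      sqDist (curvature p q) (vert p q u).1 (vert p q t).1)
    (hκR : curvature p q * sqDist (curvature p q) (vert p q u).1 (vert p q t).1 < 2)
    {x : Space p q} (hx : x ∈ triangle p q) :
    sqDist (curvature p q) (vert p q u).1 x.1 ≤
        sqDist (curvature p q) (vert p q u).1 (vert p q t).1 ∧
      (sqDist (curvature p q) (vert p q u).1 x.1 =
        sqDist (curvature p q) (vert p q u).1 (vert p q t).1 → x = vert p q t) := by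
  have hκ := curvature_cases (p := p) (q := q)
  have hX := eq_sum_vert (p := p) (q := q) hst hsu htu x.1
  have hx' := mem_triangle.1 hx
  set α := pairing (normal p q s) x.1 / height s (vert p q s) with hα
  set β := pairing (normal p q t) x.1 / height t (vert p q t) with hβ
  set γ := pairing (normal p q u) x.1 / height u (vert p q u) with hγ
  have hα0 : 0 ≤ α := div_nonneg (hx' s) (height_vert_self_pos s).le
  have hβ0 : 0 ≤ β := div_nonneg (hx' t) (height_vert_self_pos t).le
  have hγ0 : 0 ≤ γ := div_nonneg (hx' u) (height_vert_self_pos u).le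
  have h1 := sum_sq_sub_one_of_eq_combination hκ _ _ _ x hX
  have h2 := sqDist_of_eq_combination hκ _ _ _ x hX
  have hDs := sqDist_nonneg hκ (vert p q u) (vert p q s)
  have hDst := sqDist_nonneg hκ (vert p q s) (vert p q t)
  set κ := curvature p q
  set R := sqDist κ (vert p q u).1 (vert p q t).1
  set r := sqDist κ (vert p q u).1 (vert p q s).1
  set S := α * β * sqDist κ (vert p q s).1 (vert p q t).1 + α * γ * r + β * γ * R with hS
  have hR0 : 0 < R := hDs.trans_lt hlt
  have hS0 : 0 ≤ S := by positivity
  -- All terms on the right are nonnegative because `κ R < 2` and `r < R`; equality forces `α = γ =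
  -- 0`.
  have key : (1 + (α + β + γ)) * (R - sqDist κ (vert p q u).1 x.1) =
      (2 - κ * R) * S + (1 + (α + β + γ)) * (γ * R + α * (R - r)) := by
    linear_combination -h2 - R * h1
  have hσ : 0 < 1 + (α + β + γ) := by positivity
  have hrR : 0 < R - r := by linarith
  have hκR' : 0 < 2 - κ * R := by linarith
  constructor
  · have : 0 ≤ (1 + (α + β + γ)) * (R - sqDist κ (vert p q u).1 x.1) := by
      rw [key]; positivity
    linarith [nonneg_of_mul_nonneg_right this hσ]
  · intro h
    rw [h, sub_self, mul_zero] at key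
    have h3 : 0 ≤ (2 - κ * R) * S := by positivity
    have h4 : 0 ≤ (1 + (α + β + γ)) * (γ * R + α * (R - r)) := by positivity
    have h5 : γ * R + α * (R - r) = 0 := by
      have : (1 + (α + β + γ)) * (γ * R + α * (R - r)) = 0 := by linarith
      exact (mul_eq_zero.1 this).resolve_left hσ.ne'
    have h6 : 0 ≤ γ * R := by positivity
    have h7 : 0 ≤ α * (R - r) := by positivity
    have hγz : γ = 0 := (mul_eq_zero.1 (show γ * R = 0 by linarith)).resolve_right hR0.ne'
    have hαz : α = 0 := (mul_eq_zero.1 (show α * (R - r) = 0 by linarith)).resolve_right hrR.ne'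
    rw [hS, hαz, hγz] at h1
    have hβ1 : β = 1 := by nlinarith
    apply Subtype.ext
    rw [hX, hαz, hβ1, hγz]
    simp

/-! ### Rotation orbits and the centre of a tile -/

theorem sum_rotation {m : ℕ} {ρ : CoxeterG p q} (hρ : ρ ^ m = 1) (v : Space p q)
    (φ : Space p q → ℝ) :
    ∑ i ∈ Finset.range m, φ (ρ ^ (i + 1) • v) = ∑ i ∈ Finset.range m, φ (ρ ^ i • v) := by
  have h1 := Finset.sum_range_succ (fun i => φ (ρ ^ i • v)) m
  have h2 := Finset.sum_range_succ' (fun i => φ (ρ ^ i • v)) m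
  rw [h1, hρ, pow_zero] at h2
  linarith

/-- The heights over two sides of the images of a point under rotation about their common vertex
add up to zero. -/
theorem sum_height_rotation {s t : Gen} (hst : s ≠ t) (v : Space p q) :
    ∑ i ∈ Finset.range (order p q s t), height s ((gen p q s * gen p q t) ^ i • v) = 0 ∧
    ∑ i ∈ Finset.range (order p q s t), height t ((gen p q s * gen p q t) ^ i • v) = 0 := by
  have hρ := gen_mul_gen_pow (p := p) (q := q) hst
  set m := order p q s t with hm
  set ρ := gen p q s * gen p q t with hρdef
  set c := Real.cos (Real.pi / m) with hc
  have hA := sum_rotation hρ v (height s)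
  have hB := sum_rotation hρ v (height t)
  set A := ∑ i ∈ Finset.range m, height s (ρ ^ i • v) with hAdef
  set B := ∑ i ∈ Finset.range m, height t (ρ ^ i • v) with hBdef
  -- Shifting the summation by one rotation gives `A + c B = 0` and `B + c A = 0`, a system with
  -- determinant `1 - c² ≠ 0`.
  have e1 : A = -(A + 2 * c * B) := by
    conv_lhs => rw [← hA]
    rw [hAdef, hBdef, Finset.mul_sum, ← Finset.sum_add_distrib, ← Finset.sum_neg_distrib]
    refine Finset.sum_congr rfl fun i _ => ?_
    rw [pow_succ', hρdef, mul_smul, mul_smul, height_gen_smul_self, height_gen_smul hst]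
  have e2 : B = -(B + 2 * c * A) := by
    conv_rhs => rw [← hA, ← hB]
    rw [hBdef, Finset.mul_sum, ← Finset.sum_add_distrib, ← Finset.sum_neg_distrib]
    refine Finset.sum_congr rfl fun i _ => ?_
    have : ρ ^ i • v = gen p q t • gen p q s • ρ ^ (i + 1) • v := by
      rw [pow_succ', mul_smul, hρdef, mul_smul, ← mul_smul (gen p q s), gen_mul_self, one_smul,
        ← mul_smul (gen p q t), gen_mul_self, one_smul]
    rw [this, height_gen_smul_self, height_gen_smul hst.symm, order_comm t s]
  have hm2 : 2 ≤ m := two_le_order s t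
  have hc1 : c ^ 2 < 1 := by
    have hm0 : (2 : ℝ) ≤ m := by exact_mod_cast hm2
    have hpi := Real.pi_pos
    have : 0 < Real.sin (Real.pi / m) := by
      refine Real.sin_pos_of_pos_of_lt_pi (by positivity) ?_
      rw [div_lt_iff₀ (by positivity)]
      nlinarith
    nlinarith [Real.sin_sq_add_cos_sq (Real.pi / m)]
  have hA0 : A * (1 - c ^ 2) = 0 := by linear_combination e1 / 2 - c / 2 * e2
  have hB0 : B * (1 - c ^ 2) = 0 := by linear_combination e2 / 2 - c / 2 * e1
  have hne : 1 - c ^ 2 ≠ 0 := by linarith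
  exact ⟨(mul_eq_zero.1 hA0).resolve_right hne, (mul_eq_zero.1 hB0).resolve_right hne⟩

/-- The vertex `u` is the only point whose distances to the images of `v` under the rotations about
`u` are at most the distance of `u` and `v`. -/
theorem eq_vert_of_sqDist_rotation_le {s t u : Gen} (hst : s ≠ t) (hsu : s ≠ u) (htu : t ≠ u)
    (v c : Space p q)
    (hκR : curvature p q * sqDist (curvature p q) (vert p q u).1 v.1 < 2)
    (hc : ∀ i, sqDist (curvature p q) c.1 ((gen p q s * gen p q t) ^ i • v).1 ≤
      sqDist (curvature p q) (vert p q u).1 v.1) : c = vert p q u := by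
  have hκ := curvature_cases (p := p) (q := q)
  set V := vert p q u with hV
  have hm2 : 2 ≤ order p q s t := two_le_order s t
  set m := order p q s t with hm
  set ρ := gen p q s * gen p q t with hρ
  set κ := curvature p q with hκdef
  set R := sqDist κ V.1 v.1 with hR
  have hm0 : (0 : ℝ) < m := by positivity
  have hρV : ∀ i : ℕ, ρ ^ i • V = V := by
    intro i
    induction i with
    | zero => simp
    | succ i ih =>
      rw [pow_succ, mul_smul, hρ, mul_smul, gen_smul_eq_self (height_vert htu),
        gen_smul_eq_self (height_vert hsu), ih]
  have hdist : ∀ i : ℕ, sqDist κ V.1 (ρ ^ i • v).1 = R := fun i => by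
    conv_lhs => rw [← hρV i]
    exact sqDist_smul _ _ _
  -- The orbit sum is a multiple `μ V` of the centre, so the sum of the squared chords from `x` to
  -- the orbit depends only on the products of `x` with itself and with `V`.
  set w : Fin 3 → ℝ := ∑ i ∈ Finset.range m, (ρ ^ i • v).1 with hw
  have hwi : ∀ j, w j = ∑ i ∈ Finset.range m, (ρ ^ i • v).1 j := fun j => by
    rw [hw, Finset.sum_apply]
  have hpair : ∀ n, pairing n w = ∑ i ∈ Finset.range m, pairing n (ρ ^ i • v).1 := fun n => by
    simp only [pairing, hwi, Finset.mul_sum, ← Finset.sum_add_distrib]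
  obtain ⟨hs0, ht0⟩ := sum_height_rotation hst v
  have hwV := eq_sum_vert (p := p) (q := q) hst hsu htu w
  have hs0' : pairing (normal p q s) w = 0 := (hpair _).trans hs0
  have ht0' : pairing (normal p q t) w = 0 := (hpair _).trans ht0
  rw [hs0', ht0', zero_div, zero_div, zero_smul, zero_smul, zero_add, zero_add] at hwV
  set μ := pairing (normal p q u) w / height u (vert p q u)
  have hwVi : ∀ j, w j = μ * V.1 j := fun j => by conv_lhs => rw [hwV]; simp [hV]
  have hnf : ∀ x : Fin 3 → ℝ,
      ∑ i ∈ Finset.range m, normalForm κ x (ρ ^ i • v).1 = μ * normalForm κ x V.1 := by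
    intro x
    have : ∑ i ∈ Finset.range m, normalForm κ x (ρ ^ i • v).1 = normalForm κ x w := by
      simp only [normalForm, hwi, Finset.mul_sum, ← Finset.sum_add_distrib]
    rw [this]
    simp only [normalForm, hwVi]; ring
  have hexp : ∀ x y : Fin 3 → ℝ,
      sqDist κ x y = normalForm κ x x + normalForm κ y y - 2 * normalForm κ x y := fun x y => by
    simp only [sqDist_eq, normalForm]; ring
  have hsum : ∀ x : Fin 3 → ℝ, ∑ i ∈ Finset.range m, sqDist κ x (ρ ^ i • v).1 =
      m * normalForm κ x x + (∑ i ∈ Finset.range m, normalForm κ (ρ ^ i • v).1 (ρ ^ i • v).1) -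
        2 * (μ * normalForm κ x V.1) := by
    intro x
    simp only [hexp, Finset.sum_sub_distrib, Finset.sum_add_distrib, Finset.sum_const,
      Finset.card_range, nsmul_eq_mul, ← Finset.mul_sum, hnf]
  have hsumV : ∑ i ∈ Finset.range m, sqDist κ V.1 (ρ ^ i • v).1 = m * R := by
    simp [hdist]
  have hsumc : ∑ i ∈ Finset.range m, sqDist κ c.1 (ρ ^ i • v).1 ≤ m * R := by
    calc _ ≤ ∑ i ∈ Finset.range m, R := Finset.sum_le_sum fun i _ => hc i
      _ = m * R := by simp
  -- In the curved cases all norms agree and `2 μ = m (2 - κ R)`; in the Euclidean case `μ = m`.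
  -- Either way the norm terms drop out when the sums at `c` and at `V` are compared.
  have hmain : 0 < μ ∧ (m - μ) * (normalForm κ c.1 c.1 - normalForm κ V.1 V.1) = 0 := by
    have hcurv : κ = 1 ∨ κ = -1 → 0 < μ := by
      intro h1
      have hsq : κ * κ = 1 := by rcases h1 with h | h <;> rw [h] <;> norm_num
      have hnorm : ∀ x : Space p q, normalForm κ x.1 x.1 = κ := by
        intro x
        have := x.2.1
        simp only [normalForm]
        change x.1 2 ^ 2 + κ * (x.1 0 ^ 2 + x.1 1 ^ 2) = 1 at this
        linear_combination κ * this - (x.1 0 ^ 2 + x.1 1 ^ 2) * hsq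
      have h2 := hsum V.1
      simp only [hnorm] at h2
      rw [hsumV, Finset.sum_const, Finset.card_range, nsmul_eq_mul] at h2
      have h3 : 2 * μ = m * (2 - κ * R) := by linear_combination κ * h2 - 2 * μ * hsq + 2 * m * hsq
      have h4 : 0 < m * (2 - κ * R) := mul_pos hm0 (by linarith)
      linarith
    rcases hκ with h | h | h
    · exact ⟨hcurv (Or.inl h), by
        rw [normalForm_self_eq (Or.inl h) c V, sub_self, mul_zero]⟩
    · have htwo : ∀ x : Space p q, x.1 2 = 1 := by
        intro x
        have h1 := x.2.1
        have h2 := x.2.2 h.le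
        change x.1 2 ^ 2 + κ * (x.1 0 ^ 2 + x.1 1 ^ 2) = 1 at h1
        rw [h] at h1
        nlinarith
      have h2 := hwVi 2
      rw [hwi, htwo] at h2
      simp only [htwo, Finset.sum_const, Finset.card_range, nsmul_eq_mul, mul_one] at h2
      rw [← h2, sub_self, zero_mul]
      exact ⟨hm0, rfl⟩
    · exact ⟨hcurv (Or.inr h), by
        rw [normalForm_self_eq (Or.inr h) c V, sub_self, mul_zero]⟩
  have hle : μ * sqDist κ c.1 V.1 ≤ 0 := by
    have h1 := hsum c.1
    have h2 := hsum V.1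
    rw [hexp c.1 V.1]
    nlinarith [hmain.2]
  refine eq_of_sqDist_eq_zero hκ (le_antisymm ?_ (sqDist_nonneg hκ c V))
  exact nonpos_of_mul_nonpos_right hle hmain.1

theorem mem_patch {D : Subgroup (CoxeterG p q)} {x : Space p q} :
    x ∈ patch D ↔ ∃ d ∈ D, ∃ y ∈ triangle p q, d • y = x := by
  simp only [patch, Set.mem_iUnion, Set.mem_smul_set, exists_prop]

/-- The isometries that map a tile to itself come from the group that forms it. -/
theorem exists_toPerm_of_smul_patch_eq {s t u : Gen} (hst : s ≠ t) (hsu : s ≠ u) (htu : t ≠ u)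
    (hlt : sqDist (curvature p q) (vert p q u).1 (vert p q s).1 <
      sqDist (curvature p q) (vert p q u).1 (vert p q t).1)
    (hκR : curvature p q * sqDist (curvature p q) (vert p q u).1 (vert p q t).1 < 2)
    {f : Equiv.Perm (Space p q)} (hf : f ∈ isometryGroup (curvature p q))
    (hfP : f • patch (Subgroup.closure {gen p q s, gen p q t}) =
      patch (Subgroup.closure {gen p q s, gen p q t})) :
    ∃ g, f = toPerm p q g := by
  set D := Subgroup.closure {gen p q s, gen p q t} with hD
  have hsD : gen p q s ∈ D := Subgroup.subset_closure (by simp)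
  have htD : gen p q t ∈ D := Subgroup.subset_closure (by simp)
  have hDV : ∀ d ∈ D, d • vert p q u = vert p q u := by
    have : D ≤ MulAction.stabilizer (CoxeterG p q) (vert p q u) := by
      rw [hD, Subgroup.closure_le]
      rintro _ (rfl | rfl)
      · exact gen_smul_eq_self (height_vert hsu)
      · exact gen_smul_eq_self (height_vert htu)
    exact fun d hd => this hd
  have hdV : ∀ d ∈ D, ∀ y : Space p q, sqDist (curvature p q) (vert p q u).1 (d • y).1 =
      sqDist (curvature p q) (vert p q u).1 y.1 := by
    intro d hd y
    conv_lhs => rw [← hDV d hd]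
    exact sqDist_smul d _ y
  have hle : ∀ x ∈ patch D, sqDist (curvature p q) (vert p q u).1 x.1 ≤
      sqDist (curvature p q) (vert p q u).1 (vert p q t).1 := by
    intro x hx
    obtain ⟨d, hd, y, hy, rfl⟩ := mem_patch.1 hx
    rw [hdV d hd]
    exact (sqDist_vert_le hst hsu htu hlt hκR hy).1
  have hfV : f (vert p q u) = vert p q u := by
    -- The rotated copies of `t` lie in the tile, hence are `f`-images of its points, and these are
    -- at most as far from `u` as `t` is.
    refine eq_vert_of_sqDist_rotation_le hst hsu htu (vert p q t) _ hκR fun i => ?_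
    have hi : (gen p q s * gen p q t) ^ i • vert p q t ∈ patch D :=
      mem_patch.2 ⟨_, D.pow_mem (D.mul_mem hsD htD) i, _, vert_mem_triangle t, rfl⟩
    rw [← hfP] at hi
    obtain ⟨y, hy, hyx⟩ := hi
    change f y = _ at hyx
    rw [← hyx, sqDist_of_mem_isometryGroup hf]
    exact hle y hy
  have hfv : f (vert p q t) ∈ patch D := by
    rw [← hfP]
    exact ⟨vert p q t, mem_patch.2 ⟨1, D.one_mem, _, vert_mem_triangle t, one_smul _ _⟩, rfl⟩
  obtain ⟨d, hd, y, hy, hdy⟩ := mem_patch.1 hfv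
  have hyv : y = vert p q t := by
    -- `f` fixes `u`, so the image of `t` is again at maximal distance from `u`, and in each
    -- triangle only one point is.
    refine (sqDist_vert_le hst hsu htu hlt hκR hy).2 ?_
    rw [← hdV d hd, hdy]
    conv_lhs => rw [← hfV]
    exact sqDist_of_mem_isometryGroup hf _ _
  subst hyv
  have hcomp : ∀ x, (toPerm p q d⁻¹ * f) x = d⁻¹ • f x := fun x => rfl
  have h := eq_one_or_eq_gen hst hsu htu
    (Subgroup.mul_mem _ (toPerm_mem_isometryGroup d⁻¹) hf)
    (by rw [hcomp, ← hdy, inv_smul_smul])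
    (by rw [hcomp, hfV, hDV _ (D.inv_mem hd)])
  rcases h with h | h
  · refine ⟨d, ?_⟩
    rw [map_inv] at h
    exact (inv_mul_eq_one.1 h).symm
  · refine ⟨d * gen p q s, ?_⟩
    rw [map_mul, ← h, map_inv, mul_inv_cancel_left]

end Tile

/-! ### The side lengths of the triangle -/

/-- The bilinear form that takes the value `1` at the points of the plane. -/
def pointForm (κ : ℝ) (x y : Fin 3 → ℝ) : ℝ := x 2 * y 2 + κ * (x 0 * y 0 + x 1 * y 1)

theorem pointForm_comm (κ : ℝ) (x y : Fin 3 → ℝ) : pointForm κ x y = pointForm κ y x := by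
  simp only [pointForm]; ring

theorem sqDist_eq_pointForm {κ : ℝ} (hκ : κ * κ = 1) (x y : Plane κ) :
    sqDist κ x.1 y.1 = 2 * κ * (1 - pointForm κ x.1 y.1) := by
  have hx := x.2.1
  have hy := y.2.1
  rw [sqDist_eq, pointForm]
  linear_combination κ * hx + κ * hy - (x.1 0 ^ 2 + x.1 1 ^ 2 + y.1 0 ^ 2 + y.1 1 ^ 2 -
    2 * (x.1 0 * y.1 0 + x.1 1 * y.1 1)) * hκ

section SideLengths

variable {p q : ℕ} [hp : Fact (3 ≤ p)] [hq : Fact (3 ≤ q)]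

/-- In the curved cases this and the next two values are the cosines, or hyperbolic cosines, of the
sides. The value for the hypotenuse `ac` is the product of those for the legs: Pythagoras' theorem.
-/
theorem pointForm_vert_ab :
    pointForm (curvature p q) (vert p q .a).1 (vert p q .b).1 = - normalAx p q := by
  simp [pointForm, vert, faceCentre, edgeMidpoint]

theorem pointForm_vert_ac :
    pointForm (curvature p q) (vert p q .a).1 (vert p q .c).1 =
      - normalAx p q * Real.cos (Real.pi / p) / Real.sin (Real.pi / q) := by
  simp [pointForm, vert, faceCentre, vertexPoint]; ring

theorem pointForm_vert_bc :
    pointForm (curvature p q) (vert p q .b).1 (vert p q .c).1 =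
      Real.cos (Real.pi / p) / Real.sin (Real.pi / q) := by
  have h := normalA_sq p q
  simp [pointForm, vert, edgeMidpoint, vertexPoint]
  linear_combination (Real.sin (Real.pi / q))⁻¹ * Real.cos (Real.pi / p) * h

theorem pointForm_vert_pos (s t : Gen) :
    0 < pointForm (curvature p q) (vert p q s).1 (vert p q t).1 := by
  have hx : 0 < - normalAx p q := neg_pos.2 (normalAx_neg p q)
  have hc := cos_pi_div_pos p hp.out
  have hs := sin_pi_div_pos q hq.out
  have hab : 0 < pointForm (curvature p q) (vert p q .a).1 (vert p q .b).1 := by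
    rw [pointForm_vert_ab]; exact hx
  have hac : 0 < pointForm (curvature p q) (vert p q .a).1 (vert p q .c).1 := by
    rw [pointForm_vert_ac]; positivity
  have hbc : 0 < pointForm (curvature p q) (vert p q .b).1 (vert p q .c).1 := by
    rw [pointForm_vert_bc]; positivity
  have hself : ∀ s, 0 < pointForm (curvature p q) (vert p q s).1 (vert p q s).1 := fun s => by
    have := (vert p q s).2.1
    rw [pointForm, ← pow_two, ← pow_two, ← pow_two, this]; exact one_pos
  cases s <;> cases t <;> first
    | exact hself _
    | assumption
    | (rw [pointForm_comm]; assumption)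

theorem curvature_mul_self_or :
    curvature p q * curvature p q = 1 ∨ curvature p q = 0 := by
  rcases curvature_cases (p := p) (q := q) with h | h | h <;> simp [h]

/-- On the sphere this says that the sides are shorter than a quarter of a great circle; it is
automatic when `κ ≤ 0`. -/
theorem curvature_mul_sqDist_vert_lt (s t : Gen) :
    curvature p q * sqDist (curvature p q) (vert p q s).1 (vert p q t).1 < 2 := by
  rcases curvature_mul_self_or (p := p) (q := q) with h | h
  · rw [sqDist_eq_pointForm h, ← mul_assoc, mul_left_comm, h]
    linarith [pointForm_vert_pos (p := p) (q := q) s t]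
  · rw [mul_eq_zero_of_left h]; norm_num

/-- In the Euclidean case the triangle has a side of length `1`. -/
theorem euclidean_coordinates (h : curvature p q = 0) :
    normalAx p q = -1 ∧ normalAz p q = 1 ∧
      Real.sin (Real.pi / p) = Real.cos (Real.pi / q) ∧
      Real.sin (Real.pi / q) = Real.cos (Real.pi / p) := by
  have hx := normalAx_neg p q
  have hsq := normalA_sq p q
  rw [h] at hsq
  have hx1 : normalAx p q = -1 := by nlinarith
  have hmul := normalAx_mul_sin (p := p) (q := q)
  rw [hx1] at hmul
  have hsp : Real.sin (Real.pi / p) = Real.cos (Real.pi / q) := by linarith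
  refine ⟨hx1, by rw [normalAz, if_pos h], hsp, ?_⟩
  have h1 := Real.sin_sq_add_cos_sq (Real.pi / p)
  have h2 := Real.sin_sq_add_cos_sq (Real.pi / q)
  rw [hsp] at h1
  exact (pow_left_inj₀ (sin_pi_div_pos q hq.out).le (cos_pi_div_pos p hp.out).le two_ne_zero).1
    (by linarith)

theorem euclidean_sqDist (h : curvature p q = 0) :
    sqDist (curvature p q) (vert p q .a).1 (vert p q .b).1 = 1 ∧
    sqDist (curvature p q) (vert p q .a).1 (vert p q .c).1 =
      1 + (Real.sin (Real.pi / p) / Real.cos (Real.pi / p)) ^ 2 ∧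
    sqDist (curvature p q) (vert p q .b).1 (vert p q .c).1 =
      (Real.sin (Real.pi / p) / Real.cos (Real.pi / p)) ^ 2 := by
  obtain ⟨hx, hz, -, hs⟩ := euclidean_coordinates h
  have hc := (cos_pi_div_pos p hp.out).ne'
  simp [sqDist_eq, vert, faceCentre, edgeMidpoint, vertexPoint, hx, hz, hs, h, hc]
  field_simp

/-- Both quantities express that a leg has positive length: its cosine is less than `1`, or its
hyperbolic cosine greater than `1`. Multiplied by a positive conjugate they become visibly positive.
-/
theorem curvature_mul_pos (h : curvature p q * curvature p q = 1) :
    0 < curvature p q * (1 + normalAx p q) ∧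
      0 < curvature p q * (Real.sin (Real.pi / q) - Real.cos (Real.pi / p)) := by
  have hx := normalAx_neg p q
  have hz := normalAz_pos (p := p) (q := q)
  have hsq := normalA_sq p q
  have hmul := normalAx_mul_sin (p := p) (q := q)
  have hs := sin_pi_div_pos p hp.out
  have hs' := sin_pi_div_pos q hq.out
  have hc := cos_pi_div_pos p hp.out
  have h1 := Real.sin_sq_add_cos_sq (Real.pi / p)
  have h2 := Real.sin_sq_add_cos_sq (Real.pi / q)
  have e1 : curvature p q * (1 + normalAx p q) * (1 - normalAx p q) = normalAz p q ^ 2 := by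
    linear_combination normalAz p q ^ 2 * h - curvature p q * hsq
  have e2 : curvature p q * (Real.sin (Real.pi / q) - Real.cos (Real.pi / p)) *
      (Real.sin (Real.pi / q) + Real.cos (Real.pi / p)) =
      normalAz p q ^ 2 * Real.sin (Real.pi / p) ^ 2 := by
    have : Real.cos (Real.pi / q) ^ 2 = normalAx p q ^ 2 * Real.sin (Real.pi / p) ^ 2 := by
      rw [← mul_pow, hmul, neg_sq]
    linear_combination curvature p q * (h2 - h1 - this) + Real.sin (Real.pi / p) ^ 2 *
      (normalAz p q ^ 2 * h - curvature p q * hsq)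
  constructor
  · refine pos_of_mul_pos_left (b := 1 - normalAx p q) ?_ (by linarith)
    rw [e1]; positivity
  · refine pos_of_mul_pos_left (b := Real.sin (Real.pi / q) + Real.cos (Real.pi / p)) ?_
      (by linarith)
    rw [e2]; positivity

/-- A leg is shorter than the hypotenuse, since by Pythagoras the values of `pointForm` differ by
the factor belonging to the other leg. -/
theorem sqDist_vert_cb_lt : sqDist (curvature p q) (vert p q .c).1 (vert p q .b).1 <
    sqDist (curvature p q) (vert p q .c).1 (vert p q .a).1 := by
  rw [sqDist_comm, sqDist_comm _ _ (vert p q .a).1]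
  rcases curvature_mul_self_or (p := p) (q := q) with h | h
  · have hs := sin_pi_div_pos q hq.out
    have hc := cos_pi_div_pos p hp.out
    rw [sqDist_eq_pointForm h, sqDist_eq_pointForm h, pointForm_vert_ac, pointForm_vert_bc]
    have := mul_pos (curvature_mul_pos h).1 (div_pos hc hs)
    have e : curvature p q * (1 + normalAx p q) *
        (Real.cos (Real.pi / p) / Real.sin (Real.pi / q)) = curvature p q *
        (Real.cos (Real.pi / p) / Real.sin (Real.pi / q)) - curvature p q *
        (-normalAx p q * Real.cos (Real.pi / p) / Real.sin (Real.pi / q)) := by ring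
    nlinarith
  · obtain ⟨-, h2, h3⟩ := euclidean_sqDist h
    rw [h2, h3]; linarith

theorem sqDist_vert_ab_lt : sqDist (curvature p q) (vert p q .a).1 (vert p q .b).1 <
    sqDist (curvature p q) (vert p q .a).1 (vert p q .c).1 := by
  rcases curvature_mul_self_or (p := p) (q := q) with h | h
  · have hs := sin_pi_div_pos q hq.out
    have hc := cos_pi_div_pos p hp.out
    have hx := normalAx_neg p q
    rw [sqDist_eq_pointForm h, sqDist_eq_pointForm h, pointForm_vert_ac, pointForm_vert_ab]
    have := mul_pos (curvature_mul_pos h).2 (div_pos (neg_pos.2 hx) hs)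
    have e : curvature p q * (Real.sin (Real.pi / q) - Real.cos (Real.pi / p)) *
        (-normalAx p q / Real.sin (Real.pi / q)) = curvature p q * (-normalAx p q) -
        curvature p q * (-normalAx p q * Real.cos (Real.pi / p) / Real.sin (Real.pi / q)) := by
      field_simp
      ring
    nlinarith
  · obtain ⟨h1, h2, -⟩ := euclidean_sqDist h
    have := div_pos (sin_pi_div_pos p hp.out) (cos_pi_div_pos p hp.out)
    rw [h1, h2]
    linarith [pow_pos this 2]

theorem eq_of_pi_div_eq {m n : ℕ} (hm : 3 ≤ m) (hn : 3 ≤ n)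
    (h : Real.pi / m = Real.pi / n) : m = n := by
  have hm0 : (m : ℝ) ≠ 0 := by positivity
  have hn0 : (n : ℝ) ≠ 0 := by positivity
  have hpi := Real.pi_ne_zero
  field_simp at h
  exact_mod_cast h.symm

theorem sqDist_vert_ba_ne (hpq : p ≠ q) :
    sqDist (curvature p q) (vert p q .b).1 (vert p q .a).1 ≠
    sqDist (curvature p q) (vert p q .b).1 (vert p q .c).1 := by
  intro heq
  apply hpq
  obtain ⟨hp1, hp2⟩ := pi_div_bounds p hp.out
  obtain ⟨hq1, hq2⟩ := pi_div_bounds q hq.out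
  have hs := sin_pi_div_pos q hq.out
  have hs' := sin_pi_div_pos p hp.out
  have hc := cos_pi_div_pos p hp.out
  have hc' := cos_pi_div_pos q hq.out
  rw [sqDist_comm] at heq
  rcases curvature_mul_self_or (p := p) (q := q) with h | h
  · rw [sqDist_eq_pointForm h, sqDist_eq_pointForm h, pointForm_vert_ab, pointForm_vert_bc] at heq
    have hκ0 : curvature p q ≠ 0 := by intro h0; rw [h0] at h; norm_num at h
    have h1 : - normalAx p q = Real.cos (Real.pi / p) / Real.sin (Real.pi / q) := by
      have := mul_left_cancel₀ (mul_ne_zero two_ne_zero hκ0) heq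
      linarith
    have h2 : Real.cos (Real.pi / q) * Real.sin (Real.pi / q) =
        Real.cos (Real.pi / p) * Real.sin (Real.pi / p) := by
      rw [eq_div_iff hs.ne'] at h1
      have := normalAx_mul_sin (p := p) (q := q)
      linear_combination Real.sin (Real.pi / p) * h1 + Real.sin (Real.pi / q) * this
    have h3 := Real.sin_sq_add_cos_sq (Real.pi / p)
    have h4 := Real.sin_sq_add_cos_sq (Real.pi / q)
    -- Equal legs mean `sin (2π / p) = sin (2π / q)`. Squared and factored, this leaves `p = q` or
    -- `π / p + π / q = π / 2`, and the second is the excluded Euclidean case.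
    have h5 : (Real.cos (Real.pi / q) ^ 2 - Real.cos (Real.pi / p) ^ 2) *
        (Real.sin (Real.pi / p) ^ 2 - Real.cos (Real.pi / q) ^ 2) = 0 := by
      have h6 := congrArg (· ^ 2) h2
      simp only [mul_pow] at h6
      have e1 : Real.sin (Real.pi / p) ^ 2 = 1 - Real.cos (Real.pi / p) ^ 2 := by linarith
      have e2 : Real.sin (Real.pi / q) ^ 2 = 1 - Real.cos (Real.pi / q) ^ 2 := by linarith
      rw [e1, e2] at h6
      rw [e1]
      linear_combination h6
    rcases mul_eq_zero.1 h5 with h6 | h6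
    · have h7 := (pow_left_inj₀ hc'.le hc.le two_ne_zero).1 (sub_eq_zero.1 h6)
      exact (eq_of_pi_div_eq hq.out hp.out (Real.injOn_cos ⟨hq1.le, by linarith⟩
        ⟨hp1.le, by linarith⟩ h7)).symm
    · have h7 := (pow_left_inj₀ hs'.le hc'.le two_ne_zero).1 (sub_eq_zero.1 h6)
      exact absurd (curvature_eq_zero_of_cos_eq_sin hp.out hq.out h7.symm) hκ0
  · obtain ⟨h1, -, h3⟩ := euclidean_sqDist h
    obtain ⟨-, -, -, h4⟩ := euclidean_coordinates h
    rw [h1, h3] at heq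
    have h5 : Real.sin (Real.pi / p) / Real.cos (Real.pi / p) = 1 :=
      (pow_left_inj₀ (div_pos hs' hc).le zero_le_one two_ne_zero).1 (by rw [← heq, one_pow])
    rw [div_eq_one_iff_eq hc.ne', ← h4] at h5
    exact eq_of_pi_div_eq hp.out hq.out (Real.injOn_sin ⟨by linarith, by linarith⟩
      ⟨by linarith, by linarith⟩ h5)

variable (p q) in
/-- The triangle has an interior point. -/
theorem exists_interior_point : ∃ x : Space p q, ∀ s, 0 < height s x := by
  set w : Fin 3 → ℝ := (vert p q .a).1 + (vert p q .b).1 + (vert p q .c).1 with hw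
  have hexp : pointForm (curvature p q) w w = ∑ i : Fin 3, ∑ j : Fin 3,
      pointForm (curvature p q) (vert p q (![Gen.a, Gen.b, Gen.c] i)).1
        (vert p q (![Gen.a, Gen.b, Gen.c] j)).1 := by
    simp [Fin.sum_univ_three, hw, pointForm]
    ring
  -- The sum of the vertices has a positive square, a sum of nine positive products, so it can be
  -- scaled onto the plane.
  have hpos : 0 < pointForm (curvature p q) w w := by
    rw [hexp]
    exact Finset.sum_pos (fun i _ => Finset.sum_pos (fun j _ => pointForm_vert_pos _ _)
      Finset.univ_nonempty) Finset.univ_nonempty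
  set r := (Real.sqrt (pointForm (curvature p q) w w))⁻¹ with hr
  have hr0 : 0 < r := inv_pos.2 (Real.sqrt_pos.2 hpos)
  have hr2 : r ^ 2 * pointForm (curvature p q) w w = 1 := by
    rw [hr, inv_pow, Real.sq_sqrt hpos.le, inv_mul_cancel₀ hpos.ne']
  refine ⟨⟨r • w, ?_, fun h => ?_⟩, fun s => ?_⟩
  · simp only [Pi.smul_apply, smul_eq_mul]
    rw [← hr2, pointForm]; ring
  · have h1 := (vert p q .a).2.2 h
    have h2 := (vert p q .b).2.2 h
    have h3 := (vert p q .c).2.2 h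
    simp only [Pi.smul_apply, smul_eq_mul, hw, Pi.add_apply]
    positivity
  · have h : pairing (normal p q s) (r • w) = r * (height s (vert p q .a) +
        height s (vert p q .b) + height s (vert p q .c)) := by
      simp only [height, pairing, hw, Pi.smul_apply, Pi.add_apply, smul_eq_mul]; ring
    change 0 < pairing (normal p q s) (r • w)
    rw [h]
    refine mul_pos hr0 ?_
    have h0 := height_vert_self_pos (p := p) (q := q) s
    cases s <;> simpa [height_vert] using h0

end SideLengths

/-! ### Tiles and cosets -/

section Tiles

variable {p q k : ℕ} [hp : Fact (3 ≤ p)] [hq : Fact (3 ≤ q)] {D S : Subgroup (CoxeterG p q)}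

theorem smul_patch_of_mem {g : CoxeterG p q} (hg : g ∈ D) : g • patch D = patch D := by
  have h : ∀ g ∈ D, g • patch D ⊆ patch D := by
    rintro g hg _ ⟨x, hx, rfl⟩
    obtain ⟨d, hd, y, hy, rfl⟩ := mem_patch.1 hx
    exact mem_patch.2 ⟨g * d, D.mul_mem hg hd, y, hy, mul_smul _ _ _⟩
  refine (h g hg).antisymm ?_
  rw [Set.subset_smul_set_iff]
  exact h _ (D.inv_mem hg)

/-- An interior point of `gF` lies in some `h d F` with `d ∈ D`, and then `h d = g`. Containment of
a triangle in a tile is thus membership in a coset. -/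
theorem smul_triangle_subset_smul_patch {g h : CoxeterG p q} :
    g • triangle p q ⊆ h • patch D ↔ h⁻¹ * g ∈ D := by
  constructor
  · intro hsub
    obtain ⟨x, hx⟩ := exists_interior_point p q
    have hxF : x ∈ triangle p q := mem_triangle.2 fun s => (hx s).le
    obtain ⟨z, hz, hzx⟩ := hsub (Set.smul_mem_smul_set hxF)
    obtain ⟨d, hd, y, hy, rfl⟩ := mem_patch.1 hz
    change h • d • y = g • x at hzx
    have hone : d⁻¹ * (h⁻¹ * g) = 1 := by
      refine eq_one_of_smul_mem_triangle hx ?_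
      rw [mul_smul, mul_smul, ← hzx, inv_smul_smul, inv_smul_smul]
      exact hy
    rw [← inv_mul_eq_one.1 hone]
    exact hd
  · intro hd
    rw [Set.subset_smul_set_iff, ← mul_smul]
    rintro _ ⟨y, hy, rfl⟩
    exact mem_patch.2 ⟨_, hd, y, hy, rfl⟩

theorem smul_patch_eq_iff {g h : CoxeterG p q} :
    g • patch D = h • patch D ↔ h⁻¹ * g ∈ D := by
  constructor
  · intro heq
    rw [← smul_triangle_subset_smul_patch, ← heq, smul_triangle_subset_smul_patch, inv_mul_cancel]
    exact D.one_mem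
  · intro hd
    conv_rhs => rw [← smul_patch_of_mem hd, ← mul_smul, mul_inv_cancel_left]

theorem smul_triangle_injective :
    Function.Injective fun g : CoxeterG p q => g • triangle p q := by
  intro g h heq
  obtain ⟨x, hx⟩ := exists_interior_point p q
  have hxF : x ∈ triangle p q := mem_triangle.2 fun s => (hx s).le
  have hgx : g • x ∈ h • triangle p q := by
    rw [← show g • triangle p q = h • triangle p q from heq]
    exact Set.smul_mem_smul_set hxF
  rw [Set.mem_smul_set_iff_inv_smul_mem, ← mul_smul] at hgx
  exact (inv_mul_eq_one.1 (eq_one_of_smul_mem_triangle hx hgx)).symm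

variable (D) in
/-- The tile `g (⋃ d ∈ D, d F)`. -/
def tile (g : CoxeterG p q) : orbitTiling D := ⟨g • patch D, g, rfl⟩

theorem exists_eq_tile (P : orbitTiling D) : ∃ g, P = tile D g := by
  obtain ⟨_, g, rfl⟩ := P
  exact ⟨g, rfl⟩

theorem tile_eq_iff {g h : CoxeterG p q} : tile D g = tile D h ↔ h⁻¹ * g ∈ D :=
  Subtype.ext_iff.trans smul_patch_eq_iff

/-! ### Symmetry groups -/

theorem toPerm_smul_set (g : CoxeterG p q) (A : Set (Space p q)) : toPerm p q g • A = g • A := rfl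

/-- The group is transitive on tiles, so only isometries that preserve the base tile need to be
examined. -/
theorem symmetryGroup_orbitTiling
    (hD : ∀ f ∈ isometryGroup (curvature p q), f • patch D = patch D → ∃ g, f = toPerm p q g) :
    symmetryGroup (orbitTiling D) = transformationGroup p q := by
  apply le_antisymm
  · rintro f ⟨hf, hfT⟩
    have hmem : f • patch D ∈ orbitTiling D := by
      rw [← show f • orbitTiling D = orbitTiling D from hfT]
      exact Set.smul_mem_smul_set ⟨1, one_smul _ _⟩
    obtain ⟨g, hg⟩ := hmem
    change g • patch D = f • patch D at hg
    obtain ⟨h, hh⟩ := hD ((toPerm p q g)⁻¹ * f)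
      (Subgroup.mul_mem _ (Subgroup.inv_mem _ (toPerm_mem_isometryGroup g)) hf)
      (by rw [mul_smul, ← hg, ← toPerm_smul_set, inv_smul_smul])
    exact ⟨g * h, by rw [map_mul, ← hh, mul_inv_cancel_left]⟩
  · rintro _ ⟨g, rfl⟩
    refine ⟨toPerm_mem_isometryGroup g, ?_⟩
    have hsub : ∀ g : CoxeterG p q, toPerm p q g • orbitTiling D ⊆ orbitTiling D := by
      rintro g _ ⟨_, ⟨h, rfl⟩, rfl⟩
      exact ⟨g * h, mul_smul _ _ _⟩
    refine (hsub g).antisymm ?_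
    rw [Set.subset_smul_set_iff, ← map_inv]
    exact hsub g⁻¹

/-! ### Perfect colourings -/

/-- The chosen representative does not matter, as a triangle determines its group element. -/
theorem exists_isLeftCosetColouring (e : CoxeterG p q ⧸ S ≃ Fin k) :
    ∃ c : triangleTiling p q → Fin k, ∀ g : CoxeterG p q,
      c ⟨g • triangle p q, g, rfl⟩ = e (QuotientGroup.mk g) := by
  refine ⟨fun t => e (QuotientGroup.mk t.2.choose), fun g => ?_⟩
  have hex : ∃ h : CoxeterG p q, h • triangle p q = g • triangle p q := ⟨g, rfl⟩
  exact congrArg (fun h => e (QuotientGroup.mk h)) (smul_triangle_injective hex.choose_spec)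

theorem induces_of_tile (e : CoxeterG p q ⧸ S ≃ Fin k) {d : orbitTiling D → Fin k}
    (hd : ∀ g, d (tile D g) = e (QuotientGroup.mk g)) : Induces S d := by
  obtain ⟨c, hc⟩ := exists_isLeftCosetColouring e
  refine ⟨c, ⟨e, hc⟩, ?_⟩
  rintro P ⟨_, g, rfl⟩ hsub
  obtain ⟨h, rfl⟩ := exists_eq_tile P
  rw [hc, tile_eq_iff.2 (smul_triangle_subset_smul_patch.1 hsub) |>.symm, hd]

theorem Induces.exists_tile {d : orbitTiling D → Fin k} (h : Induces S d) :
    ∃ e : CoxeterG p q ⧸ S ≃ Fin k, ∀ g, ∀ x ∈ D,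
      d (tile D g) = e (QuotientGroup.mk (g * x)) := by
  obtain ⟨c, ⟨e, he⟩, hc⟩ := h
  refine ⟨e, fun g x hx => ?_⟩
  rw [← he]
  refine (hc (tile D g) ⟨(g * x) • triangle p q, g * x, rfl⟩ ?_).symm
  exact smul_triangle_subset_smul_patch.2 (by rwa [inv_mul_cancel_left])

/-- For `x ∈ D`, the triangles `F` and `xF` lie in the base tile, so they share a colour and `x`
lies in the coset `S`. -/
theorem Induces.le {d : orbitTiling D → Fin k} (h : Induces S d) : D ≤ S := by
  obtain ⟨e, he⟩ := h.exists_tile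
  intro x hx
  have h1 := (he 1 x hx).symm.trans (he 1 1 D.one_mem)
  rw [one_mul, one_mul] at h1
  have h2 := QuotientGroup.eq.1 (e.injective h1)
  rw [mul_one] at h2
  exact S.inv_mem_iff.1 h2

theorem Induces.isPerfectColouring {d : orbitTiling D → Fin k} (h : Induces S d) :
    IsPerfectColouring (transformationGroup p q) d := by
  obtain ⟨e, he⟩ := h.exists_tile
  have he' : ∀ g, d (tile D g) = e (QuotientGroup.mk g) := fun g => by
    simpa using he g 1 D.one_mem
  refine ⟨fun i => ?_, ?_⟩
  · obtain ⟨g, hg⟩ := QuotientGroup.mk_surjective (e.symm i)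
    exact ⟨tile D g, by rw [he', hg, e.apply_symm_apply]⟩
  · rintro _ ⟨g, rfl⟩
    -- The colours are permuted as the left cosets are by left multiplication.
    refine ⟨(e.symm.trans (MulAction.toPerm g)).trans e, ?_⟩
    rintro P Q hPQ
    obtain ⟨h, rfl⟩ := exists_eq_tile P
    have hQ : Q = tile D (g * h) := Subtype.ext (hPQ.trans (mul_smul g h (patch D)).symm)
    rw [hQ, he', he']
    simp

theorem IsPerfectColouring.exists_induces {d : orbitTiling D → Fin k}
    (h : IsPerfectColouring (transformationGroup p q) d) :
    ∃ S : Subgroup (CoxeterG p q), S.index = k ∧ Induces S d := by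
  obtain ⟨hsurj, hperf⟩ := h
  have hπ : ∀ g : CoxeterG p q, ∃ π : Equiv.Perm (Fin k),
      ∀ h, d (tile D (g * h)) = π (d (tile D h)) := by
    intro g
    obtain ⟨π, hπ⟩ := hperf (toPerm p q g) ⟨g, rfl⟩
    exact ⟨π, fun h => hπ _ _ (mul_smul g h (patch D))⟩
  choose π hπ using hπ
  -- Apply the colour permutation of `g⁻¹` to both sides. This makes `S` below, the stabiliser of
  -- the colour of the base tile, a subgroup whose left cosets are the colour classes.
  have hiff : ∀ g h : CoxeterG p q,
      d (tile D g) = d (tile D h) ↔ d (tile D (g⁻¹ * h)) = d (tile D 1) := by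
    intro g h
    rw [hπ, ← inv_mul_cancel g, hπ g⁻¹ g, (π g⁻¹).injective.eq_iff, eq_comm]
  let S : Subgroup (CoxeterG p q) :=
    { carrier := {g | d (tile D g) = d (tile D 1)}
      one_mem' := rfl
      mul_mem' := by
        intro g h hg hh
        change d (tile D (g * h)) = _
        rw [hπ, show d (tile D h) = d (tile D 1) from hh, ← hπ, mul_one]
        exact hg
      inv_mem' := by
        intro g hg
        have := (hiff g 1).1 hg
        rwa [mul_one] at this }
  let F : CoxeterG p q ⧸ S → Fin k := Quotient.lift (fun g => d (tile D g)) fun g h hgh =>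
    (hiff g h).2 (QuotientGroup.leftRel_apply.1 hgh)
  have hF : Function.Bijective F := by
    constructor
    · intro x y
      induction x using QuotientGroup.induction_on with | H g =>
      induction y using QuotientGroup.induction_on with | H h =>
      exact fun hgh => QuotientGroup.eq.2 ((hiff g h).1 hgh)
    · intro i
      obtain ⟨P, rfl⟩ := hsurj i
      obtain ⟨g, rfl⟩ := exists_eq_tile P
      exact ⟨QuotientGroup.mk g, rfl⟩
  let e := Equiv.ofBijective F hF
  refine ⟨S, ?_, induces_of_tile e fun g => rfl⟩
  rw [Subgroup.index, Nat.card_congr e, Nat.card_eq_fintype_card, Fintype.card_fin]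

theorem isPerfectColouring_iff {d : orbitTiling D → Fin k} :
    IsPerfectColouring (transformationGroup p q) d ↔
      ∃ S : Subgroup (CoxeterG p q), S.index = k ∧ D ≤ S ∧ Induces S d := by
  constructor
  · intro h
    obtain ⟨S, hk, hS⟩ := h.exists_induces
    exact ⟨S, hk, hS.le, hS⟩
  · rintro ⟨S, -, -, hS⟩
    exact hS.isPerfectColouring

theorem inducesPerfect_iff (hk : 0 < k) (hS : S.index = k) :
    InducesPerfect k (transformationGroup p q) S (orbitTiling D) ↔ D ≤ S := by
  constructor
  · rintro ⟨d, -, hd⟩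
    exact hd.le
  · intro hDS
    have hcard : Nat.card (CoxeterG p q ⧸ S) = k := hS
    -- Index `0` stands for infinite index, so positivity of `k` is what makes the quotient finite.
    have : Finite (CoxeterG p q ⧸ S) := Nat.finite_of_card_ne_zero (by omega)
    let e : CoxeterG p q ⧸ S ≃ Fin k := Finite.equivFinOfCardEq hcard
    have hind : Induces S (fun P : orbitTiling D => e (QuotientGroup.mk P.2.choose)) := by
      refine induces_of_tile e fun g => ?_
      have hex : ∃ h : CoxeterG p q, h • patch D = g • patch D := ⟨g, rfl⟩
      refine congrArg e (QuotientGroup.eq.2 ?_)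
      have := S.inv_mem (hDS (smul_patch_eq_iff.1 hex.choose_spec))
      rwa [mul_inv_rev, inv_inv] at this
    exact ⟨_, hind.isPerfectColouring, hind⟩

/-! ### Vertex stabilisers and symmetry groups of the three tilings -/

theorem closure_pair_le {x y : CoxeterG p q} :
    Subgroup.closure {x, y} ≤ S ↔ x ∈ S ∧ y ∈ S := by
  rw [Subgroup.closure_le, Set.insert_subset_iff, Set.singleton_subset_iff]; rfl

theorem stabilizer_vert {s t u : Gen} (hst : s ≠ t) (hsu : s ≠ u) (htu : t ≠ u) :
    MulAction.stabilizer (CoxeterG p q) (vert p q u) =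
      Subgroup.closure {gen p q s, gen p q t} := by
  apply le_antisymm
  · intro g hg
    refine mem_of_smul_eq_self (vert_mem_triangle u) _ (fun r hr => ?_) hg
    have hru : r ≠ u := by
      rintro rfl
      exact (height_vert_self_pos r).ne' hr
    have : r = s ∨ r = t := by cases r <;> cases s <;> cases t <;> cases u <;> simp_all
    rcases this with rfl | rfl <;> exact Subgroup.subset_closure (by simp)
  · exact closure_pair_le.2
      ⟨gen_smul_eq_self (height_vert hsu), gen_smul_eq_self (height_vert htu)⟩

theorem symmetryGroup_eq {s t u : Gen} (hst : s ≠ t) (hsu : s ≠ u) (htu : t ≠ u)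
    (hlt : sqDist (curvature p q) (vert p q u).1 (vert p q s).1 <
      sqDist (curvature p q) (vert p q u).1 (vert p q t).1) :
    symmetryGroup (orbitTiling (Subgroup.closure {gen p q s, gen p q t})) =
      transformationGroup p q :=
  symmetryGroup_orbitTiling fun _ hf hfP => exists_toPerm_of_smul_patch_eq hst hsu htu hlt
    (curvature_mul_sqDist_vert_lt u t) hf hfP

theorem symmetryGroup_tilingQP : symmetryGroup (tilingQP p q) = transformationGroup p q := by
  have h := symmetryGroup_eq (p := p) (q := q) (s := .b) (t := .a) (u := .c) (by simp) (by simp)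
    (by simp) sqDist_vert_cb_lt
  rwa [Set.pair_comm] at h

theorem symmetryGroup_tilingPQ : symmetryGroup (tilingPQ p q) = transformationGroup p q :=
  symmetryGroup_eq (p := p) (q := q) (s := .b) (t := .c) (u := .a) (by simp) (by simp)
    (by simp) sqDist_vert_ab_lt

/-- Which leg is longer depends on `p` and `q`; the longer one supplies the farthest vertex of the
tile. -/
theorem symmetryGroup_tilingLaves (hpq : p ≠ q) :
    symmetryGroup (tilingLaves p q) = transformationGroup p q := by
  rcases (sqDist_vert_ba_ne hpq).lt_or_gt with h | h
  · exact symmetryGroup_eq (s := .a) (t := .c) (u := .b) (by simp) (by simp) (by simp) h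
  · have h' := symmetryGroup_eq (s := .c) (t := .a) (u := .b) (by simp) (by simp) (by simp) h
    rwa [Set.pair_comm] at h'

end Tiles

end PerfectColouring

theorem mainTheorem1 (p q k : ℕ) [Fact (3 ≤ p)] [Fact (3 ≤ q)] (hk : 0 < k) :
    -- `G_{p,q}` is the symmetry group of the tilings (of the Laves tiling if `p ≠ q`)
    (symmetryGroup (tilingQP p q) = transformationGroup p q ∧
      symmetryGroup (tilingPQ p q) = transformationGroup p q ∧
      (p ≠ q → symmetryGroup (tilingLaves p q) = transformationGroup p q)) ∧
    -- the subgroups of index `k` that induce perfect `k`-colourings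
    (∀ S : Subgroup (CoxeterG p q), S.index = k →
      (InducesPerfect k (transformationGroup p q) S (tilingQP p q) ↔ genA p q ∈ S ∧ genB p q ∈ S) ∧
      (InducesPerfect k (transformationGroup p q) S (tilingPQ p q) ↔ genB p q ∈ S ∧ genC p q ∈ S) ∧
      (InducesPerfect k (transformationGroup p q) S (tilingLaves p q) ↔
        genA p q ∈ S ∧ genC p q ∈ S)) ∧
    -- the perfect `k`-colourings are the colourings induced by such subgroups
    (∀ d : tilingQP p q → Fin k, IsPerfectColouring (transformationGroup p q) d ↔
      ∃ S : Subgroup (CoxeterG p q), S.index = k ∧ genA p q ∈ S ∧ genB p q ∈ S ∧ Induces S d) ∧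
    (∀ d : tilingPQ p q → Fin k, IsPerfectColouring (transformationGroup p q) d ↔
      ∃ S : Subgroup (CoxeterG p q), S.index = k ∧ genB p q ∈ S ∧ genC p q ∈ S ∧ Induces S d) ∧
    (∀ d : tilingLaves p q → Fin k, IsPerfectColouring (transformationGroup p q) d ↔
      ∃ S : Subgroup (CoxeterG p q), S.index = k ∧ genA p q ∈ S ∧ genC p q ∈ S ∧ Induces S d) ∧
    -- the stabilisers of a vertex, a face centre and an edge midpoint of `(p^q)`
    MulAction.stabilizer (CoxeterG p q) (vertexPoint p q) =
      Subgroup.closure {genA p q, genB p q} ∧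
    MulAction.stabilizer (CoxeterG p q) (faceCentre p q) =
      Subgroup.closure {genB p q, genC p q} ∧
    MulAction.stabilizer (CoxeterG p q) (edgeMidpoint p q) =
      Subgroup.closure {genA p q, genC p q} := by
  refine ⟨⟨symmetryGroup_tilingQP, symmetryGroup_tilingPQ, symmetryGroup_tilingLaves⟩,
    fun S hS => ⟨(inducesPerfect_iff hk hS).trans closure_pair_le,
      (inducesPerfect_iff hk hS).trans closure_pair_le,
      (inducesPerfect_iff hk hS).trans closure_pair_le⟩,
    fun d => ?_, fun d => ?_, fun d => ?_,
    stabilizer_vert (s := .a) (t := .b) (u := .c) (by simp) (by simp) (by simp),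
    stabilizer_vert (s := .b) (t := .c) (u := .a) (by simp) (by simp) (by simp),
    stabilizer_vert (s := .a) (t := .c) (u := .b) (by simp) (by simp) (by simp)⟩
  all_goals
    refine isPerfectColouring_iff.trans ?_
    simp only [closure_pair_le, and_assoc]
    exact Iff.rfl
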